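/- Let $R>0$, let $\Delta=\{z\in\mathbb C:|z|<R\}$, and let $\rho:\widetilde\Delta\to\Delta$ be its real blow-up in the origin, i.e. $\widetilde\Delta=[0,R)\times S^1$ with $\rho(r,u)=ru$, with exceptional divisor $E=\rho^{-1}(0)=\{0\}\times S^1$. Consider the following sheaves of complex vector spaces on $\widetilde\Delta$. * $\mathcal A^0_{\widetilde\Delta}$ is the sheaf of complex valued functions that are $C^\infty$ up to the boundary $E$ (that is, $C^\infty$ in polar coordinates $(r,t)\mapsto(r,e^{it})$, $r\ge 0$). * $\mathcal O_{\widetilde\Delta}\subset\mathcal A^0_{\widetilde\Delta}$ is the subsheaf of those functions that are holomorphic on the complement of $E$. * $\mathcal A^{0,1}_{\widetilde\Delta}(\log E)$ is the sheaf of $(0,1)$-forms of the shape $\psi\,\frac{d\bar z}{\bar z}$ with $\psi$ a section of $\mathcal A^0_{\widetilde\Delta}$. The operator $\bar\partial f=\frac{\partial f}{\partial\bar z}\,d\bar z$ on $\Delta\setminus\{0\}$ extends to a map $\bar\partial:\mathcal A^0_{\widetilde\Delta}\to\mathcal A^{0,1}_{\widetilde\Delta}(\log E)$. Then the sequence of sheaves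 $$0\longrightarrow\mathcal O_{\widetilde\Delta}\longrightarrow\mathcal A^0_{\widetilde\Delta}\xrightarrow{\ \bar\partial\ }\mathcal A^{0,1}_{\widetilde\Delta}(\log E)\longrightarrow 0$$ is exact, i.e. $\bar\partial$ is a resolution of $\mathcal O_{\widetilde\Delta}$. -/

import Mathlib

noncomputable section

open CategoryTheory TopologicalSpace Opposite
open scoped ContDiff Topology ComplexConjugate

namespace RealBlowup

/-! ### Sheaves of `ℂ`-vector spaces cut out by a local linear condition -/

/-- A local, `ℂ`-linear condition on sections (over open sets) of a family `T` of complex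
vector spaces on a topological space `X`. -/
structure LinearLocalCondition (X : TopCat.{0}) (T : X → Type)
    [∀ x, AddCommGroup (T x)] [∀ x, Module ℂ (T x)] where
  sections : ∀ U : Opens X, Submodule ℂ (∀ x : U, T x)
  res : ∀ {U V : Opens X} (h : V ≤ U) (f : ∀ x : U, T x), f ∈ sections U →
    (fun x : V => f ⟨x, h x.2⟩) ∈ sections V
  locality : ∀ (U : Opens X) (f : ∀ x : U, T x),
    (∀ x ∈ U, ∃ (V : Opens X) (h : V ≤ U), x ∈ V ∧
      (fun y : V => f ⟨y, h y.2⟩) ∈ sections V) → f ∈ sections U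

namespace LinearLocalCondition

variable {X : TopCat.{0}} {T : X → Type} [∀ x, AddCommGroup (T x)] [∀ x, Module ℂ (T x)]

/-- The presheaf of sections satisfying the condition, with the usual restriction maps. -/
def presheaf (P : LinearLocalCondition X T) : TopCat.Presheaf (ModuleCat.{0} ℂ) X where
  obj U := ModuleCat.of ℂ (P.sections U.unop)
  map {U V} i := ModuleCat.ofHom
    { toFun := fun f => ⟨fun x => f.1 ⟨x, i.unop.le x.2⟩, P.res i.unop.le f.1 f.2⟩
      map_add' := fun _ _ => rfl
      map_smul' := fun _ _ => rfl }

theorem presheaf_isSheaf (P : LinearLocalCondition X T) : P.presheaf.IsSheaf := by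
  rw [TopCat.Presheaf.isSheaf_iff_isSheafUniqueGluing]
  intro ι U sf hsf
  have key : ∀ (i j : ι) (x : X) (hi : x ∈ U i) (hj : x ∈ U j),
      (sf i).1 ⟨x, hi⟩ = (sf j).1 ⟨x, hj⟩ := by
    intro i j x hi hj
    have := congrArg (fun s => s.1 ⟨x, ⟨hi, hj⟩⟩) (hsf i j)
    exact this
  have hmem : ∀ x : (iSup U : Opens X), ∃ i, (x : X) ∈ U i := fun x =>
    Opens.mem_iSup.1 x.2
  choose idx hidx using hmem
  refine ⟨⟨fun x => (sf (idx x)).1 ⟨x, hidx x⟩, ?_⟩, ?_, ?_⟩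
  · refine P.locality _ _ fun x hx => ?_
    refine ⟨U (idx ⟨x, hx⟩), le_iSup U _, hidx ⟨x, hx⟩, ?_⟩
    convert (sf (idx ⟨x, hx⟩)).2 using 1
    funext y
    exact key _ _ _ _ _
  · intro i
    apply Subtype.ext
    funext y
    exact key _ _ _ _ _
  · intro s hs
    apply Subtype.ext
    funext y
    have := congrArg (fun s => s.1 ⟨(y : X), hidx y⟩) (hs (idx y))
    exact this

/-- The sheaf of sections satisfying the condition. -/
def sheaf (P : LinearLocalCondition X T) : TopCat.Sheaf (ModuleCat.{0} ℂ) X :=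
  ⟨P.presheaf, P.presheaf_isSheaf⟩

/-- A morphism of sheaves given by linear maps on sections commuting with restriction. -/
def homMk {T' : X → Type} [∀ x, AddCommGroup (T' x)] [∀ x, Module ℂ (T' x)]
    (P : LinearLocalCondition X T) (Q : LinearLocalCondition X T')
    (φ : ∀ U : Opens X, P.sections U →ₗ[ℂ] Q.sections U)
    (hφ : ∀ {U V : Opens X} (h : V ≤ U) (f : P.sections U) (x : V),
      (φ V ⟨fun x => f.1 ⟨x, h x.2⟩, P.res h f.1 f.2⟩).1 x = (φ U f).1 ⟨x, h x.2⟩) :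
    P.sheaf ⟶ Q.sheaf :=
  ⟨{ app := fun U => ModuleCat.ofHom (φ U.unop)
     naturality := by
      intro U V i
      ext f
      apply Subtype.ext
      funext x
      exact hφ i.unop.le f x }⟩

end LinearLocalCondition

/-! ### The real blow-up of a disc and polar coordinates -/

/-- The real blow-up of the disc `|z| < R` in the origin: the cylinder `[0, R) × S¹`. -/
abbrev Space (R : ℝ) : TopCat.{0} := TopCat.of {p : ℝ × Circle // 0 ≤ p.1 ∧ p.1 < R}

variable {R : ℝ}

/-- The blow-down map `ρ (r, u) = r u` to the disc. -/
def blowDown (x : Space R) : ℂ := (x.1.1 : ℂ) * (x.1.2 : ℂ)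

/-- The exceptional divisor `E = ρ⁻¹ (0)`. -/
def excDivisor (R : ℝ) : Set (Space R) := {x | blowDown x = 0}

/-- Polar coordinates `(r, t) ↦ (r, e^{it})`. -/
def polar (q : ℝ × ℝ) : ℝ × Circle := (q.1, Circle.exp q.2)

/-- The open set `U` of the blow-up seen in polar coordinates, a subset of `[0, R) × ℝ`. -/
def polarDomain (U : Opens (Space R)) : Set (ℝ × ℝ) := {q | ∃ x ∈ U, x.1 = polar q}

/-- A function on `U` written in polar coordinates (extended by `0` off `polarDomain U`). -/
def inPolar {U : Opens (Space R)} (f : U → ℂ) (q : ℝ × ℝ) : ℂ :=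
  Function.extend (fun x : U => x.1.1) f 0 (polar q)

/-- A function on `U` seen as a function of `z = ρ x` (only meaningful on `ρ (U \ E)`, where `ρ` is
injective). -/
def inPlane {U : Opens (Space R)} (f : U → ℂ) : ℂ → ℂ :=
  Function.extend (fun x : U => blowDown x.1) f 0

/-- `f` is smooth up to the boundary: it is `C^∞` in the polar coordinates `(r, t)`, with all
derivatives extending continuously to `r = 0`. -/
def IsSmooth {U : Opens (Space R)} (f : U → ℂ) : Prop :=
  ContDiffOn ℝ ∞ (inPolar f) (polarDomain U)

/-- `f` is holomorphic on the complement of the exceptional divisor. -/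
def IsHolomorphicOffE {U : Opens (Space R)} (f : U → ℂ) : Prop :=
  ∀ x : U, x.1 ∉ excDivisor R → DifferentiableAt ℂ (inPlane f) (blowDown x.1)

theorem inPolar_eq {U : Opens (Space R)} (f : U → ℂ) (x : U) {q : ℝ × ℝ}
    (h : x.1.1 = polar q) : inPolar f q = f x := by
  have hinj : Function.Injective (fun x : U => x.1.1) := fun a b hab =>
    Subtype.ext (Subtype.ext hab)
  rw [inPolar, ← h]
  exact hinj.extend_apply f 0 x

theorem norm_blowDown (x : Space R) : ‖blowDown x‖ = x.1.1 := by
  rw [blowDown, norm_mul, Circle.norm_coe, mul_one, Complex.norm_real, Real.norm_eq_abs,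
    abs_of_nonneg x.2.1]

theorem notMem_excDivisor {x : Space R} : x ∉ excDivisor R ↔ 0 < x.1.1 := by
  have : x ∈ excDivisor R ↔ x.1.1 = 0 := by
    rw [← norm_blowDown, norm_eq_zero]; rfl
  rw [this]
  exact ⟨fun h => lt_of_le_of_ne x.2.1 (Ne.symm h), fun h => h.ne'⟩

theorem blowDown_inj {x y : Space R} (hx : x ∉ excDivisor R) (h : blowDown x = blowDown y) :
    x = y := by
  have h1 : x.1.1 = y.1.1 := by rw [← norm_blowDown, ← norm_blowDown, h]
  have h0 : (x.1.1 : ℂ) ≠ 0 := by exact_mod_cast (notMem_excDivisor.1 hx).ne'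
  have h2 : x.1.2 = y.1.2 := by
    apply Circle.ext
    have h' := h
    rw [blowDown, blowDown, ← h1] at h'
    exact mul_left_cancel₀ h0 h'
  exact Subtype.ext (Prod.ext h1 h2)

theorem inPlane_eq {U : Opens (Space R)} (f : U → ℂ) (x : U) (hx : x.1 ∉ excDivisor R) :
    inPlane f (blowDown x.1) = f x := by
  have hex : ∃ a : U, blowDown a.1 = blowDown x.1 := ⟨x, rfl⟩
  classical
  rw [inPlane, Function.extend_def, dif_pos hex]
  congr 1
  exact (Subtype.ext (blowDown_inj hx (Classical.choose_spec hex).symm)).symm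

theorem continuous_polar : Continuous polar := by
  unfold polar; fun_prop

theorem mem_polarDomain {U : Opens (Space R)} {x : Space R} {q : ℝ × ℝ} (h : x.1 = polar q) :
    q ∈ polarDomain U ↔ x ∈ U := by
  constructor
  · rintro ⟨y, hy, hyq⟩
    have : x = y := Subtype.ext (h.trans hyq.symm)
    rwa [this]
  · exact fun hx => ⟨x, hx, h⟩

theorem exists_isOpen_polarDomain (U : Opens (Space R)) :
    ∃ O : Set (ℝ × ℝ), IsOpen O ∧ polarDomain U = (Set.Ici 0 ×ˢ Set.univ) ∩ O := by
  obtain ⟨W, hW, hWU⟩ := isOpen_induced_iff.1 U.2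
  refine ⟨polar ⁻¹' W ∩ {q | q.1 < R}, (hW.preimage continuous_polar).inter
    (isOpen_lt continuous_fst continuous_const), ?_⟩
  ext q
  constructor
  · rintro ⟨x, hx, hxq⟩
    have h1 : x.1.1 = q.1 := by rw [hxq]; rfl
    have h2 : x ∈ Subtype.val ⁻¹' W := by rw [hWU]; exact hx
    refine ⟨⟨h1 ▸ x.2.1, trivial⟩, ?_, show q.1 < R from h1 ▸ x.2.2⟩
    rw [Set.mem_preimage, ← hxq]
    exact h2
  · rintro ⟨⟨h0, -⟩, h1, h2⟩
    refine ⟨⟨polar q, h0, h2⟩, ?_, rfl⟩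
    have : (⟨polar q, h0, h2⟩ : Space R) ∈ Subtype.val ⁻¹' W := h1
    rw [hWU] at this
    exact this

theorem uniqueDiffOn_polarDomain (U : Opens (Space R)) : UniqueDiffOn ℝ (polarDomain U) := by
  obtain ⟨O, hO, h⟩ := exists_isOpen_polarDomain U
  rw [h]
  exact ((uniqueDiffOn_Ici 0).prod uniqueDiffOn_univ).inter hO

theorem polarDomain_mem_nhdsWithin {U V : Opens (Space R)} {q : ℝ × ℝ}
    (hq : q ∈ polarDomain V) : polarDomain V ∈ 𝓝[polarDomain U] q := by
  obtain ⟨O, hO, h⟩ := exists_isOpen_polarDomain U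
  obtain ⟨O', hO', h'⟩ := exists_isOpen_polarDomain V
  rw [h'] at hq
  rw [h, h']
  exact mem_nhdsWithin.2 ⟨O', hO', hq.2, fun y hy => ⟨hy.2.1, hy.1⟩⟩

theorem polarDomain_mem_nhds {U : Opens (Space R)} {q : ℝ × ℝ}
    (hq : q ∈ polarDomain U) (h0 : 0 < q.1) : polarDomain U ∈ 𝓝 q := by
  obtain ⟨O, hO, h⟩ := exists_isOpen_polarDomain U
  rw [h] at hq ⊢
  refine Filter.inter_mem ?_ (hO.mem_nhds hq.2)
  exact Filter.mem_of_superset ((isOpen_Ioi.preimage continuous_fst).mem_nhds h0)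
    fun y (hy : 0 < y.1) => ⟨hy.le, trivial⟩

theorem polarDomain_mono {U V : Opens (Space R)} (h : V ≤ U) : polarDomain V ⊆ polarDomain U :=
  fun _ ⟨x, hx, hq⟩ => ⟨x, h hx, hq⟩

theorem inPolar_res {U V : Opens (Space R)} (h : V ≤ U) (f : U → ℂ) :
    Set.EqOn (inPolar fun x : V => f ⟨x, h x.2⟩) (inPolar f) (polarDomain V) := by
  rintro q ⟨x, hx, hq⟩
  rw [inPolar_eq _ ⟨x, hx⟩ hq, inPolar_eq f ⟨x, h hx⟩ hq]

theorem IsSmooth.res {U V : Opens (Space R)} (h : V ≤ U) {f : U → ℂ} (hf : IsSmooth f) :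
    IsSmooth (fun x : V => f ⟨x, h x.2⟩) :=
  (ContDiffOn.mono hf (polarDomain_mono h)).congr (inPolar_res h f)

theorem IsSmooth.of_local {U : Opens (Space R)} {f : U → ℂ}
    (hf : ∀ x ∈ U, ∃ (V : Opens (Space R)) (h : V ≤ U), x ∈ V ∧
      IsSmooth (fun y : V => f ⟨y, h y.2⟩)) : IsSmooth f := by
  rintro q ⟨x, hx, hq⟩
  obtain ⟨V, h, hxV, hV⟩ := hf x hx
  have hqV : q ∈ polarDomain V := ⟨x, hxV, hq⟩
  have h1 : ContDiffWithinAt ℝ ∞ (inPolar f) (polarDomain V) q :=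
    (hV q hqV).congr (fun y hy => (inPolar_res h f hy).symm) (inPolar_res h f hqV).symm
  exact h1.mono_of_mem_nhdsWithin (polarDomain_mem_nhdsWithin hqV)

theorem inPolar_add {U : Opens (Space R)} (f g : U → ℂ) :
    inPolar (f + g) = inPolar f + inPolar g := by
  funext q
  have := congrFun (Function.extend_add (fun x : U => x.1.1) f g 0 0) (polar q)
  simpa [inPolar] using this

theorem inPolar_smul {U : Opens (Space R)} (c : ℂ) (f : U → ℂ) :
    inPolar (c • f) = c • inPolar f := by
  funext q
  have := congrFun (Function.extend_smul c (fun x : U => x.1.1) f 0) (polar q)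
  simpa [inPolar] using this

theorem inPolar_zero {U : Opens (Space R)} : inPolar (0 : U → ℂ) = 0 := by
  simpa using inPolar_smul 0 (0 : U → ℂ)

theorem inPlane_add {U : Opens (Space R)} (f g : U → ℂ) :
    inPlane (f + g) = inPlane f + inPlane g := by
  have := Function.extend_add (fun x : U => blowDown x.1) f g 0 0
  simpa [inPlane] using this

theorem inPlane_smul {U : Opens (Space R)} (c : ℂ) (f : U → ℂ) :
    inPlane (c • f) = c • inPlane f := by
  have := Function.extend_smul c (fun x : U => blowDown x.1) f 0
  simpa [inPlane] using this

theorem inPlane_zero {U : Opens (Space R)} : inPlane (0 : U → ℂ) = 0 := by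
  simpa using inPlane_smul 0 (0 : U → ℂ)

theorem IsSmooth.add {U : Opens (Space R)} {f g : U → ℂ} (hf : IsSmooth f) (hg : IsSmooth g) :
    IsSmooth (f + g) := by
  rw [IsSmooth, inPolar_add]; exact ContDiffOn.add hf hg

theorem IsSmooth.smul {U : Opens (Space R)} {f : U → ℂ} (c : ℂ) (hf : IsSmooth f) :
    IsSmooth (c • f) := by
  rw [IsSmooth, inPolar_smul]; exact ContDiffOn.const_smul c hf

theorem isSmooth_zero {U : Opens (Space R)} : IsSmooth (0 : U → ℂ) := by
  rw [IsSmooth, inPolar_zero]; exact contDiffOn_const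

/-! ### Differentiability off the exceptional divisor -/

/-- A branch of polar coordinates on `ℂ` around the ray of angle `t`. -/
def branch (t : ℝ) (z : ℂ) : ℝ × ℝ := (‖z‖, t + (Complex.log (z / (Circle.exp t : ℂ))).im)

theorem exists_polar (x : Space R) : ∃ t : ℝ, x.1 = polar (x.1.1, t) :=
  ⟨Complex.arg x.1.2, Prod.ext rfl (Circle.exp_arg _).symm⟩

theorem blowDown_eq {x : Space R} {q : ℝ × ℝ} (h : x.1 = polar q) :
    blowDown x = (q.1 : ℂ) * (Circle.exp q.2 : ℂ) := by
  rw [blowDown, h, polar]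

theorem blowDown_div {x : Space R} {t : ℝ} (ht : x.1 = polar (x.1.1, t)) :
    blowDown x / (Circle.exp t : ℂ) = (x.1.1 : ℂ) := by
  rw [blowDown_eq ht, mul_div_cancel_right₀ _ (Circle.coe_ne_zero _)]

theorem branch_blowDown {x : Space R} {t : ℝ} (ht : x.1 = polar (x.1.1, t)) :
    branch t (blowDown x) = (x.1.1, t) := by
  rw [branch, blowDown_div ht, norm_blowDown, Complex.log_im,
    Complex.arg_ofReal_of_nonneg x.2.1, add_zero]

theorem differentiableAt_branch {x : Space R} (hx : x ∉ excDivisor R) {t : ℝ}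
    (ht : x.1 = polar (x.1.1, t)) : DifferentiableAt ℝ (branch t) (blowDown x) := by
  have hz0 : blowDown x ≠ 0 := hx
  have hlog : DifferentiableAt ℂ (fun z : ℂ => Complex.log (z / (Circle.exp t : ℂ)))
      (blowDown x) := by
    refine DifferentiableAt.clog (differentiableAt_id.div_const _) ?_
    rw [blowDown_div ht]
    exact Complex.ofReal_mem_slitPlane.2 (notMem_excDivisor.1 hx)
  exact (differentiableAt_id.norm ℝ hz0).prodMk ((differentiableAt_const _).add
    (Complex.imCLM.differentiableAt.comp _ (hlog.restrictScalars ℝ)))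

theorem blowDown_of_eq_branch {y : Space R} {t : ℝ} {z : ℂ} (h : y.1 = polar (branch t z)) :
    blowDown y = z := by
  rw [blowDown_eq h]
  simp only [branch]
  rw [Circle.exp_add, Circle.coe_mul, Circle.coe_exp (Complex.im _), Complex.log_im]
  have h3 := Complex.norm_mul_exp_arg_mul_I (z / (Circle.exp t : ℂ))
  rw [norm_div, Circle.norm_coe, div_one] at h3
  rw [mul_left_comm, h3, mul_div_cancel₀ _ (Circle.coe_ne_zero _)]

/-- `ρ` maps `U \ E` to an open subset of the plane. -/
theorem eventually_branch (U : Opens (Space R)) {x : Space R} (hxU : x ∈ U)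
    (hx : x ∉ excDivisor R) {t : ℝ} (ht : x.1 = polar (x.1.1, t)) :
    ∀ᶠ z in 𝓝 (blowDown x), ∃ y ∈ U, y ∉ excDivisor R ∧ blowDown y = z ∧
      y.1 = polar (branch t z) := by
  have hmem : polarDomain U ∈ 𝓝 (branch t (blowDown x)) := by
    rw [branch_blowDown ht]
    exact polarDomain_mem_nhds ⟨x, hxU, ht⟩ (notMem_excDivisor.1 hx)
  have hev := (differentiableAt_branch hx ht).continuousAt.eventually hmem
  have hz0 : blowDown x ≠ 0 := hx
  filter_upwards [hev, isOpen_ne.mem_nhds hz0] with z hz hz0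
  obtain ⟨y, hy, hyq⟩ := hz
  have hyz := blowDown_of_eq_branch hyq
  exact ⟨y, hy, fun h => hz0 (hyz ▸ h), hyz, hyq⟩

theorem inPlane_eventuallyEq {U : Opens (Space R)} (f : U → ℂ) (x : U)
    (hx : x.1 ∉ excDivisor R) {t : ℝ} (ht : x.1.1 = polar (x.1.1.1, t)) :
    inPlane f =ᶠ[𝓝 (blowDown x.1)] inPolar f ∘ branch t := by
  filter_upwards [eventually_branch U x.2 hx ht] with z ⟨y, hy, hyE, hyz, hyq⟩
  rw [Function.comp_apply, inPolar_eq f ⟨y, hy⟩ hyq, ← inPlane_eq f ⟨y, hy⟩ hyE]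
  exact congrArg _ hyz.symm

theorem inPlane_res {U V : Opens (Space R)} (h : V ≤ U) (f : U → ℂ) (x : V)
    (hx : x.1 ∉ excDivisor R) :
    (inPlane fun y : V => f ⟨y, h y.2⟩) =ᶠ[𝓝 (blowDown x.1)] inPlane f := by
  obtain ⟨t, ht⟩ := exists_polar x.1
  filter_upwards [eventually_branch V x.2 hx ht] with z ⟨y, hy, hyE, hyz, hyq⟩
  rw [← hyz]
  exact (inPlane_eq _ ⟨y, hy⟩ hyE).trans (inPlane_eq f ⟨y, h hy⟩ hyE).symm

theorem IsSmooth.differentiableAt_inPolar {U : Opens (Space R)} {f : U → ℂ} (hf : IsSmooth f)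
    {q : ℝ × ℝ} (hq : q ∈ polarDomain U) (h0 : 0 < q.1) : DifferentiableAt ℝ (inPolar f) q :=
  (ContDiffOn.contDiffAt hf (polarDomain_mem_nhds hq h0)).differentiableAt (by simp)

theorem IsSmooth.differentiableAt_inPlane {U : Opens (Space R)} {f : U → ℂ} (hf : IsSmooth f)
    (x : U) (hx : x.1 ∉ excDivisor R) : DifferentiableAt ℝ (inPlane f) (blowDown x.1) := by
  obtain ⟨t, ht⟩ := exists_polar x.1
  refine DifferentiableAt.congr_of_eventuallyEq ?_ (inPlane_eventuallyEq f x hx ht)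
  refine DifferentiableAt.comp _ ?_ (differentiableAt_branch hx ht)
  rw [branch_blowDown ht]
  exact hf.differentiableAt_inPolar ⟨x.1, x.2, ht⟩ (notMem_excDivisor.1 hx)

/-! ### The operator `z̄ ∂/∂z̄` up to the boundary -/

/-- The Wirtinger derivative `∂g/∂z̄`. -/
def wirtingerBar (g : ℂ → ℂ) (z : ℂ) : ℂ :=
  (1 / 2) * (fderiv ℝ g z 1 + Complex.I * fderiv ℝ g z Complex.I)

/-- `½ (r ∂/∂r + i ∂/∂t)` in polar coordinates `(r, t)`, with one-sided derivatives at `r = 0`. -/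
def polarDbar {U : Opens (Space R)} (f : U → ℂ) (q : ℝ × ℝ) : ℂ :=
  (1 / 2) * ((q.1 : ℂ) * fderivWithin ℝ (inPolar f) (polarDomain U) q (1, 0) +
    Complex.I * fderivWithin ℝ (inPolar f) (polarDomain U) q (0, 1))

/-- The function `D̄ f` on `U`, equal to `z̄ ∂f/∂z̄` off the exceptional divisor. -/
def dbarCoeff {U : Opens (Space R)} (f : U → ℂ) (x : U) : ℂ :=
  polarDbar f (x.1.1.1, Complex.arg x.1.1.2)

open scoped Pointwise in
theorem polarDbar_congr {U : Opens (Space R)} (f : U → ℂ) {r s t : ℝ}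
    (h : Circle.exp s = Circle.exp t) : polarDbar f (r, s) = polarDbar f (r, t) := by
  obtain ⟨m, hm⟩ := Circle.exp_eq_exp.1 h
  have hpol : ∀ q : ℝ × ℝ, polar (q + (0, m * (2 * Real.pi))) = polar q := by
    intro q
    simp only [polar, Prod.fst_add, Prod.snd_add, add_zero]
    rw [Circle.exp_add, Circle.exp_int_mul_two_pi, mul_one]
  have hF : (fun q => inPolar f (q + (0, m * (2 * Real.pi)))) = inPolar f := by
    funext q; rw [inPolar, hpol, inPolar]
  have hS : ((0 : ℝ), m * (2 * Real.pi)) +ᵥ polarDomain U = polarDomain U := by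
    ext q
    rw [Set.mem_vadd_set_iff_neg_vadd_mem]
    have h1 := hpol (-((0 : ℝ), m * (2 * Real.pi)) + q)
    rw [neg_add_cancel_comm] at h1
    simp only [polarDomain, Set.mem_ofPred_eq, vadd_eq_add, h1]
  have hs : ((r, s) : ℝ × ℝ) = (r, t) + (0, m * (2 * Real.pi)) := by
    rw [Prod.mk_add_mk, add_zero, hm]
  have key := fderivWithin_comp_add_right (𝕜 := ℝ) (f := inPolar f) (s := polarDomain U)
    (x := (r, t)) ((0 : ℝ), (m : ℝ) * (2 * Real.pi))
  rw [hF, hS, ← hs] at key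
  simp only [polarDbar, key]

theorem inPolar_dbarCoeff {U : Opens (Space R)} (f : U → ℂ) :
    Set.EqOn (inPolar (dbarCoeff f)) (polarDbar f) (polarDomain U) := by
  rintro ⟨r, t⟩ ⟨x, hx, hq⟩
  rw [inPolar_eq _ ⟨x, hx⟩ hq, dbarCoeff]
  have h1 : x.1.1 = r := congrArg Prod.fst hq
  have h2 : x.1.2 = Circle.exp t := congrArg Prod.snd hq
  simp only [h1]
  exact polarDbar_congr f ((Circle.exp_arg _).trans h2)

theorem IsSmooth.dbarCoeff {U : Opens (Space R)} {f : U → ℂ} (hf : IsSmooth f) :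
    IsSmooth (dbarCoeff f) := by
  refine ContDiffOn.congr ?_ (inPolar_dbarCoeff f)
  have hD : ContDiffOn ℝ ∞ (fderivWithin ℝ (inPolar f) (polarDomain U)) (polarDomain U) :=
    ContDiffOn.fderivWithin hf (uniqueDiffOn_polarDomain U) (by simp)
  have h1 : ContDiffOn ℝ ∞ (fun q : ℝ × ℝ => (q.1 : ℂ)) (polarDomain U) :=
    (Complex.ofRealCLM.contDiff.comp contDiff_fst).contDiffOn
  exact contDiffOn_const.mul ((h1.mul (hD.clm_apply contDiffOn_const)).add
    (contDiffOn_const.mul (hD.clm_apply contDiffOn_const)))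

theorem dbarCoeff_eq {U : Opens (Space R)} {f : U → ℂ} (hf : IsSmooth f) (x : U)
    (hx : x.1 ∉ excDivisor R) :
    dbarCoeff f x = conj (blowDown x.1) * wirtingerBar (inPlane f) (blowDown x.1) := by
  set t := Complex.arg x.1.1.2 with ht_def
  have ht : x.1.1 = polar (x.1.1.1, t) := Prod.ext rfl (Circle.exp_arg _).symm
  set r := x.1.1.1 with hr_def
  have hr : 0 < r := notMem_excDivisor.1 hx
  have hq : (r, t) ∈ polarDomain U := ⟨x.1, x.2, ht⟩
  have hnhds := polarDomain_mem_nhds hq hr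
  let P : ℝ × ℝ → ℂ := fun q => (q.1 : ℂ) * Complex.exp (q.2 * Complex.I)
  have hPval : P (r, t) = blowDown x.1 := by
    rw [blowDown_eq ht, Circle.coe_exp]
  have hFP : inPolar f =ᶠ[𝓝 (r, t)] inPlane f ∘ P := by
    have hpos : ∀ᶠ q : ℝ × ℝ in 𝓝 (r, t), 0 < q.1 :=
      continuousAt_fst.eventually (lt_mem_nhds hr)
    filter_upwards [hnhds, hpos] with q ⟨y, hy, hyq⟩ hq0
    have hyE : y ∉ excDivisor R := by
      rw [notMem_excDivisor, hyq]; exact hq0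
    rw [inPolar_eq f ⟨y, hy⟩ hyq, ← inPlane_eq f ⟨y, hy⟩ hyE, Function.comp_apply]
    congr 1
    rw [blowDown_eq hyq, Circle.coe_exp]
  have hcr : HasFDerivAt (fun q : ℝ × ℝ => (q.1 : ℂ))
      (Complex.ofRealCLM.comp (ContinuousLinearMap.fst ℝ ℝ ℝ)) (r, t) :=
    (Complex.ofRealCLM.comp (ContinuousLinearMap.fst ℝ ℝ ℝ)).hasFDerivAt
  have hct : HasFDerivAt (fun q : ℝ × ℝ => (q.2 : ℂ))
      (Complex.ofRealCLM.comp (ContinuousLinearMap.snd ℝ ℝ ℝ)) (r, t) :=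
    (Complex.ofRealCLM.comp (ContinuousLinearMap.snd ℝ ℝ ℝ)).hasFDerivAt
  have hP := hcr.mul ((hct.mul_const Complex.I).cexp)
  have hG := (hf.differentiableAt_inPlane x hx).hasFDerivAt
  rw [← hPval] at hG
  have hcomp := (hG.comp (r, t) hP).congr_of_eventuallyEq hFP
  have hW : fderivWithin ℝ (inPolar f) (polarDomain U) (r, t) = _ :=
    (fderivWithin_of_mem_nhds hnhds).trans hcomp.fderiv
  have hlin : ∀ (L : ℂ →L[ℝ] ℂ) (w : ℂ), L w = w.re * L 1 + w.im * L Complex.I := by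
    intro L w
    conv_lhs => rw [← Complex.re_add_im w]
    have h1 : ((w.re : ℂ) + w.im * Complex.I) = w.re • (1 : ℂ) + w.im • Complex.I := by
      simp [Complex.real_smul]
    rw [h1, map_add, map_smul, map_smul, Complex.real_smul, Complex.real_smul]
  rw [RealBlowup.dbarCoeff, polarDbar, wirtingerBar, ← hPval, ← ht_def, ← hr_def, hW]
  generalize fderiv ℝ (inPlane f) (P (r, t)) = L
  have e1 : Complex.exp ((t : ℂ) * Complex.I) = (Real.cos t : ℂ) + (Real.sin t : ℂ) * Complex.I := by
    rw [Complex.exp_mul_I, Complex.ofReal_cos, Complex.ofReal_sin]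
  simp only [ContinuousLinearMap.comp_apply, P]
  simp only [add_apply, smul_apply, ContinuousLinearMap.comp_apply, ContinuousLinearMap.coe_fst',
    ContinuousLinearMap.coe_snd', Complex.ofRealCLM_apply, e1]
  generalize (Real.cos t) = c, (Real.sin t) = s
  have a1 : (r : ℂ) • ((c : ℂ) + (s : ℂ) * Complex.I) • Complex.I • ((0 : ℝ) : ℂ) +
      ((c : ℂ) + (s : ℂ) * Complex.I) • ((1 : ℝ) : ℂ) = (c : ℂ) + (s : ℂ) * Complex.I := by simp
  have a2 : (r : ℂ) • ((c : ℂ) + (s : ℂ) * Complex.I) • Complex.I • ((1 : ℝ) : ℂ) +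
      ((c : ℂ) + (s : ℂ) * Complex.I) • ((0 : ℝ) : ℂ) =
        ((-(r * s) : ℝ) : ℂ) + ((r * c : ℝ) : ℂ) * Complex.I := by
    simp only [smul_eq_mul]
    push_cast
    linear_combination (r : ℂ) * s * Complex.I_mul_I
  rw [a1, a2, hlin L (_ + _), hlin L (_ + _)]
  simp only [map_mul, map_add, Complex.conj_ofReal, Complex.conj_I,
    Complex.add_re, Complex.add_im, Complex.mul_re, Complex.mul_im, Complex.ofReal_re,
    Complex.ofReal_im, Complex.I_re, Complex.I_im, mul_zero, mul_one, sub_zero,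
    add_zero, zero_add]
  push_cast
  linear_combination (1 / 2 * (r : ℂ) * s * L Complex.I) * Complex.I_mul_I

theorem wirtingerBar_add {g h : ℂ → ℂ} {z : ℂ} (hg : DifferentiableAt ℝ g z)
    (hh : DifferentiableAt ℝ h z) :
    wirtingerBar (g + h) z = wirtingerBar g z + wirtingerBar h z := by
  rw [wirtingerBar, wirtingerBar, wirtingerBar, fderiv_add hg hh]
  simp only [add_apply]
  ring

theorem wirtingerBar_smul {g : ℂ → ℂ} {z : ℂ} (c : ℂ) (hg : DifferentiableAt ℝ g z) :
    wirtingerBar (c • g) z = c * wirtingerBar g z := by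
  rw [wirtingerBar, wirtingerBar, fderiv_const_smul hg]
  simp only [smul_apply, smul_eq_mul]
  ring

theorem wirtingerBar_of_holomorphic {g : ℂ → ℂ} {z : ℂ} (hg : DifferentiableAt ℂ g z) :
    wirtingerBar g z = 0 := by
  have h1 : fderiv ℝ g z = (fderiv ℂ g z).restrictScalars ℝ :=
    (hg.hasFDerivAt.restrictScalars ℝ).fderiv
  have h2 : fderiv ℂ g z Complex.I = Complex.I * fderiv ℂ g z 1 := by
    rw [← smul_eq_mul, ← map_smul, smul_eq_mul, mul_one]
  rw [wirtingerBar, h1, ContinuousLinearMap.coe_restrictScalars', h2, ← mul_assoc,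
    Complex.I_mul_I]
  ring

/-! ### The sheaves `𝒪`, `𝒜⁰`, `𝒜⁰¹(log E)` and the complex -/

/-- The `(0,1)`-covectors at a point of `ℂ`: conjugate-linear functionals on the tangent line. -/
abbrev AntiCovector : Type := ℂ →ₗ⋆[ℂ] ℂ

/-- The form `dz̄`. -/
def dzbar : AntiCovector := (starRingEnd ℂ).toSemilinearMap

/-- A family of these over an open set `U` is a `(0,1)`-form on `U \ E ⊆ Δ \ {0}`; there is no
datum at the points of `E`. -/
abbrev FormFibre (x : Space R) : Type := PLift (x ∉ excDivisor R) → AntiCovector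

/-- A section over `U` of the bundle of `(0,1)`-forms with logarithmic pole along `E`, smooth up to
the boundary: locally `α = ψ dz̄ / z̄` with `ψ` smooth up to the boundary. As `U \ E` is dense in `U`,
the section `ψ dz̄ / z̄` is determined by the form `α` on `U \ E`. -/
def IsLogForm {U : Opens (Space R)} (α : ∀ x : U, FormFibre x.1) : Prop :=
  ∀ x ∈ U, ∃ (V : Opens (Space R)) (h : V ≤ U), x ∈ V ∧ ∃ ψ : V → ℂ, IsSmooth ψ ∧
    ∀ (y : V) (hy : y.1 ∉ excDivisor R),
      α ⟨y, h y.2⟩ ⟨hy⟩ = (ψ y / conj (blowDown y.1)) • dzbar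

/-- The `(0,1)`-form `∂̄ f = (∂f/∂z̄) dz̄` on `U \ E`. -/
def dbar {U : Opens (Space R)} (f : U → ℂ) (x : U) : FormFibre x.1 :=
  fun _ => wirtingerBar (inPlane f) (blowDown x.1) • dzbar

theorem IsSmooth.isLogForm_dbar {U : Opens (Space R)} {f : U → ℂ} (hf : IsSmooth f) :
    IsLogForm (dbar f) := by
  intro x hx
  refine ⟨U, le_rfl, hx, RealBlowup.dbarCoeff f, hf.dbarCoeff, fun y hy => ?_⟩
  have h0 : conj (blowDown y.1) ≠ 0 := (map_ne_zero _).2 hy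
  rw [dbarCoeff_eq hf y hy, mul_div_cancel_left₀ _ h0]
  rfl

theorem IsHolomorphicOffE.res {U V : Opens (Space R)} (h : V ≤ U) {f : U → ℂ}
    (hf : IsHolomorphicOffE f) : IsHolomorphicOffE (fun x : V => f ⟨x, h x.2⟩) :=
  fun x hx => (hf ⟨x, h x.2⟩ hx).congr_of_eventuallyEq (inPlane_res h f x hx)

theorem IsHolomorphicOffE.of_local {U : Opens (Space R)} {f : U → ℂ}
    (hf : ∀ x ∈ U, ∃ (V : Opens (Space R)) (h : V ≤ U), x ∈ V ∧
      IsHolomorphicOffE (fun y : V => f ⟨y, h y.2⟩)) : IsHolomorphicOffE f := by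
  intro x hx
  obtain ⟨V, h, hxV, hV⟩ := hf x x.2
  exact (hV ⟨x, hxV⟩ hx).congr_of_eventuallyEq (inPlane_res h f ⟨x, hxV⟩ hx).symm

variable (R)

/-- Being smooth up to the boundary, as a local condition on functions. -/
def smoothCondition : LinearLocalCondition (Space R) (fun _ => ℂ) where
  sections _ :=
    { carrier := {f | IsSmooth f}
      add_mem' := fun hf hg => IsSmooth.add hf hg
      zero_mem' := isSmooth_zero
      smul_mem' := fun c _ hf => IsSmooth.smul c hf }
  res h _ hf := IsSmooth.res h hf
  locality _ _ hf := IsSmooth.of_local hf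

/-- Being smooth up to the boundary and holomorphic off `E`. -/
def holomorphicCondition : LinearLocalCondition (Space R) (fun _ => ℂ) where
  sections _ :=
    { carrier := {f | IsSmooth f ∧ IsHolomorphicOffE f}
      add_mem' := fun hf hg => ⟨hf.1.add hg.1, fun x hx => by
        rw [inPlane_add]; exact (hf.2 x hx).add (hg.2 x hx)⟩
      zero_mem' := ⟨isSmooth_zero, fun x _ => by
        rw [inPlane_zero]; exact differentiableAt_const _⟩
      smul_mem' := fun c f hf => ⟨hf.1.smul c, fun x hx => by
        rw [inPlane_smul]; exact (hf.2 x hx).const_smul c⟩ }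
  res h _ hf := ⟨hf.1.res h, hf.2.res h⟩
  locality _ _ hf :=
    ⟨IsSmooth.of_local fun x hx => by
      obtain ⟨V, h, hxV, hV⟩ := hf x hx
      exact ⟨V, h, hxV, hV.1⟩,
    IsHolomorphicOffE.of_local fun x hx => by
      obtain ⟨V, h, hxV, hV⟩ := hf x hx
      exact ⟨V, h, hxV, hV.2⟩⟩

/-- Being a smooth logarithmic `(0,1)`-form. -/
def logFormCondition : LinearLocalCondition (Space R) (fun x => FormFibre x) where
  sections _ :=
    { carrier := {α | IsLogForm α}
      add_mem' := by
        intro α β hα hβ x hx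
        obtain ⟨V, h, hxV, ψ, hψ, hV⟩ := hα x hx
        obtain ⟨W, k, hxW, χ, hχ, hW⟩ := hβ x hx
        refine ⟨V ⊓ W, inf_le_left.trans h, ⟨hxV, hxW⟩, _,
          (hψ.res (inf_le_left : V ⊓ W ≤ V)).add (hχ.res (inf_le_right : V ⊓ W ≤ W)), ?_⟩
        intro y hy
        have h1 := hV ⟨y, y.2.1⟩ hy
        have h2 := hW ⟨y, y.2.2⟩ hy
        simp only [Pi.add_apply] at h1 h2 ⊢
        rw [h1, h2, add_div, add_smul]
      zero_mem' := fun _ hx => ⟨_, le_rfl, hx, 0, isSmooth_zero, fun _ _ => by simp⟩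
      smul_mem' := by
        intro c α hα x hx
        obtain ⟨V, h, hxV, ψ, hψ, hV⟩ := hα x hx
        refine ⟨V, h, hxV, c • ψ, hψ.smul c, fun y hy => ?_⟩
        have h1 := hV y hy
        simp only [Pi.smul_apply] at h1 ⊢
        rw [h1, smul_smul, smul_eq_mul, mul_div_assoc] }
  res {_ V} h _ hα x hx := by
    obtain ⟨W, k, hxW, ψ, hψ, hW⟩ := hα x (h hx)
    exact ⟨W ⊓ V, inf_le_right, ⟨hxW, hx⟩, _, hψ.res (inf_le_left : W ⊓ V ≤ W),
      fun y hy => hW ⟨y, y.2.1⟩ hy⟩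
  locality _ _ hα x hx := by
    obtain ⟨V, h, hxV, hV⟩ := hα x hx
    obtain ⟨W, k, hxW, ψ, hψ, hW⟩ := hV x hxV
    exact ⟨W, k.trans h, hxW, ψ, hψ, hW⟩

/-- The sheaf `𝒪` of functions smooth up to the boundary and holomorphic off `E`. -/
def sheafO : TopCat.Sheaf (ModuleCat.{0} ℂ) (Space R) := (holomorphicCondition R).sheaf

/-- The sheaf `𝒜⁰` of complex functions smooth up to the boundary. -/
def sheafA0 : TopCat.Sheaf (ModuleCat.{0} ℂ) (Space R) := (smoothCondition R).sheaf

/-- The sheaf `𝒜⁰¹(log E)`. -/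
def sheafA01Log : TopCat.Sheaf (ModuleCat.{0} ℂ) (Space R) := (logFormCondition R).sheaf

/-- The inclusion `𝒪 ⟶ 𝒜⁰`. -/
def inclusion : sheafO R ⟶ sheafA0 R :=
  LinearLocalCondition.homMk (holomorphicCondition R) (smoothCondition R)
    (fun _ => Submodule.inclusion fun _ hf => hf.1) (fun _ _ _ => rfl)

/-- The operator `∂̄ : 𝒜⁰ ⟶ 𝒜⁰¹(log E)`. -/
def dbarHom : sheafA0 R ⟶ sheafA01Log R :=
  LinearLocalCondition.homMk (smoothCondition R) (logFormCondition R)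
    (fun U =>
      { toFun := fun f => ⟨dbar f.1, IsSmooth.isLogForm_dbar f.2⟩
        map_add' := by
          intro f g
          apply Subtype.ext
          funext x hx
          have hf := IsSmooth.differentiableAt_inPlane f.2 x hx.down
          have hg := IsSmooth.differentiableAt_inPlane g.2 x hx.down
          change wirtingerBar (inPlane (f.1 + g.1)) _ • dzbar =
            wirtingerBar (inPlane f.1) _ • dzbar + wirtingerBar (inPlane g.1) _ • dzbar
          rw [inPlane_add, wirtingerBar_add hf hg, add_smul]
        map_smul' := by
          intro c f
          apply Subtype.ext
          funext x hx
          have hf := IsSmooth.differentiableAt_inPlane f.2 x hx.down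
          change wirtingerBar (inPlane (c • f.1)) _ • dzbar =
            c • wirtingerBar (inPlane f.1) _ • dzbar
          rw [inPlane_smul, wirtingerBar_smul c hf, smul_smul] })
    (by
      intro U V h f x
      funext hx
      change wirtingerBar _ _ • dzbar = wirtingerBar _ _ • dzbar
      have := (inPlane_res h f.1 x hx.down).fderiv_eq (𝕜 := ℝ)
      simp only [wirtingerBar, this])

theorem inclusion_comp_dbarHom : inclusion R ≫ dbarHom R = 0 := by
  apply CategoryTheory.Sheaf.hom_ext
  ext U f
  apply Subtype.ext
  funext x hx
  change wirtingerBar (inPlane f.1) _ • dzbar = 0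
  rw [wirtingerBar_of_holomorphic (f.2.2 x hx.down), zero_smul]

/-- The complex `𝒪 ⟶ 𝒜⁰ ⟶ 𝒜⁰¹(log E)` of sheaves of complex vector spaces on the blow-up. -/
def logDolbeault : ShortComplex (TopCat.Sheaf (ModuleCat.{0} ℂ) (Space R)) :=
  ShortComplex.mk (inclusion R) (dbarHom R) (inclusion_comp_dbarHom R)

end RealBlowup

end

open CategoryTheory TopologicalSpace Opposite MeasureTheory Set Filter
open scoped ContDiff Topology ComplexConjugate

/-! Everything except surjectivity of `∂̄` is formal: sections of `𝒪` are functions in `𝒜⁰`, and a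
smooth function killed by `∂̄` off `E` satisfies the Cauchy–Riemann equations there. Surjectivity is
local, so the content is a `∂̄`-lemma with smoothness up to the boundary
(`IsLogForm.exists_dbar_eq`).

In polar coordinates the equation reads `½ (r ∂/∂r + i ∂/∂t) F = φ`, where `φ` may be cut off to
have bounded support. With `r = e^s` the operator becomes the Cauchy–Riemann operator in `s + it`,
so one convolves with the Cauchy kernel `1/ζ`. But `E` lies at `s = -∞`, where `φ` does not decay,
and `1/ζ` is not integrable along a strip. The remedy is to use `e^{-ζ²}/ζ` instead. As `e^{-ζ²}` is
holomorphic with value `1` at `0`, this is still a fundamental solution up to a constant, and it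
decays like a Gaussian on horizontal strips. Since `φ` is supported in a strip, the kernel may be
truncated to a wider strip without affecting the equation near `t₀`.

The convolution `∫ φ(r e^{-s}, t - u) k(s, u)` makes sense at `r = 0` as well. Each `∂/∂r` produces
a factor `e^{-s}`, and the Gaussian absorbs all powers of it, so the result is smooth up to the
boundary (`contDiffOn_mellinConv`). That it solves the equation for `r > 0` is the Cauchy–Pompeiu
formula (`integral_dbar_div`, `mellinConv_gaussCauchyKernel`). -/

namespace RealBlowup

/-! ### Uniform estimates for functions smooth up to the boundary -/

/-- The closed half plane `r ≥ 0` of polar coordinates `(r, t)`. -/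
def halfPlane : Set (ℝ × ℝ) := Ici 0 ×ˢ univ

theorem mem_halfPlane {q : ℝ × ℝ} : q ∈ halfPlane ↔ 0 ≤ q.1 := by simp [halfPlane]

theorem uniqueDiffOn_halfPlane : UniqueDiffOn ℝ halfPlane :=
  (uniqueDiffOn_Ici 0).prod uniqueDiffOn_univ

theorem convex_halfPlane : Convex ℝ halfPlane := (convex_Ici 0).prod convex_univ

theorem isClosed_halfPlane : IsClosed halfPlane := isClosed_Ici.prod isClosed_univ

theorem halfPlane_mem_nhds {q : ℝ × ℝ} (hq : 0 < q.1) : halfPlane ∈ 𝓝 q :=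
  mem_of_superset ((isOpen_lt continuous_const continuous_fst).mem_nhds hq)
    fun _ hy => mem_halfPlane.2 (le_of_lt hy)

/-- Functions smooth up to the boundary of the half plane, with bounded support. -/
structure IsTest (φ : ℝ × ℝ → ℂ) : Prop where
  smooth : ContDiffOn ℝ ∞ φ halfPlane
  bddSupport : ∃ C, ∀ q ∈ halfPlane, C < ‖q‖ → φ q = 0

namespace IsTest

variable {φ : ℝ × ℝ → ℂ}

theorem exists_bound (hφ : IsTest φ) : ∃ C, 0 ≤ C ∧ ∀ q ∈ halfPlane, ‖φ q‖ ≤ C := by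
  obtain ⟨B, hB⟩ := hφ.bddSupport
  have hK : IsCompact (halfPlane ∩ Metric.closedBall 0 B) :=
    (isCompact_closedBall 0 B).inter_left isClosed_halfPlane
  obtain ⟨C, hC⟩ := hK.exists_bound_of_continuousOn
    (hφ.smooth.continuousOn.mono inter_subset_left)
  refine ⟨max C 0, le_max_right _ _, fun q hq => ?_⟩
  by_cases h : B < ‖q‖
  · rw [hB q hq h, norm_zero]
    exact le_max_right _ _
  · exact (hC q ⟨hq, by simpa using h⟩).trans (le_max_left _ _)

theorem fderivWithin_apply (hφ : IsTest φ) (v : ℝ × ℝ) :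
    IsTest (fun q => fderivWithin ℝ φ halfPlane q v) where
  smooth := (hφ.smooth.fderivWithin uniqueDiffOn_halfPlane (by simp)).clm_apply contDiffOn_const
  bddSupport := by
    obtain ⟨B, hB⟩ := hφ.bddSupport
    refine ⟨B, fun q hq hqB => ?_⟩
    have h0 : φ =ᶠ[𝓝[halfPlane] q] fun _ => 0 := by
      filter_upwards [self_mem_nhdsWithin, mem_nhdsWithin_of_mem_nhds
        ((isOpen_lt continuous_const continuous_norm).mem_nhds hqB)] with y hy hyB
      exact hB y hy hyB
    rw [h0.fderivWithin_eq (hB q hq hqB)]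
    simp

theorem hasFDerivWithinAt (hφ : IsTest φ) {q : ℝ × ℝ} (hq : q ∈ halfPlane) :
    HasFDerivWithinAt φ (fderivWithin ℝ φ halfPlane q) halfPlane q :=
  (hφ.smooth.differentiableOn (by simp) q hq).hasFDerivWithinAt

theorem exists_fderivWithin_bound (hφ : IsTest φ) :
    ∃ C, 0 ≤ C ∧ ∀ q ∈ halfPlane, ‖fderivWithin ℝ φ halfPlane q‖ ≤ C := by
  obtain ⟨C₁, h₁, hC₁⟩ := (hφ.fderivWithin_apply (1, 0)).exists_bound
  obtain ⟨C₂, h₂, hC₂⟩ := (hφ.fderivWithin_apply (0, 1)).exists_bound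
  refine ⟨C₁ + C₂, by positivity, fun q hq => ?_⟩
  refine ContinuousLinearMap.opNorm_le_bound _ (by positivity) fun v => ?_
  have hv : v = v.1 • ((1 : ℝ), (0 : ℝ)) + v.2 • ((0 : ℝ), (1 : ℝ)) := by ext <;> simp
  have h1 : ‖v.1‖ ≤ ‖v‖ := norm_fst_le v
  have h2 : ‖v.2‖ ≤ ‖v‖ := norm_snd_le v
  conv_lhs => rw [hv, map_add, map_smul, map_smul]
  refine (norm_add_le _ _).trans ?_
  rw [norm_smul, norm_smul]
  have := mul_le_mul h1 (hC₁ q hq) (norm_nonneg _) (norm_nonneg _)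
  have := mul_le_mul h2 (hC₂ q hq) (norm_nonneg _) (norm_nonneg _)
  nlinarith

theorem exists_lipschitz (hφ : IsTest φ) :
    ∃ C, 0 ≤ C ∧ ∀ x ∈ halfPlane, ∀ y ∈ halfPlane, ‖φ y - φ x‖ ≤ C * ‖y - x‖ := by
  obtain ⟨C, h, hC⟩ := hφ.exists_fderivWithin_bound
  exact ⟨C, h, fun x hx y hy => convex_halfPlane.norm_image_sub_le_of_norm_hasFDerivWithin_le
    (fun z hz => hφ.hasFDerivWithinAt hz) hC hx hy⟩

/-- The derivative is globally Lipschitz and the half plane is convex, so the mean value inequality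
on the segment from `x` to `y` gives a quadratic error. The constant is uniform in `x`, boundary
points included, so the estimate can be integrated against a kernel. -/
theorem exists_taylor_bound (hφ : IsTest φ) :
    ∃ C, 0 ≤ C ∧ ∀ x ∈ halfPlane, ∀ y ∈ halfPlane,
      ‖φ y - φ x - fderivWithin ℝ φ halfPlane x (y - x)‖ ≤ C * ‖y - x‖ ^ 2 := by
  obtain ⟨C₁, h₁, hC₁⟩ := (hφ.fderivWithin_apply (1, 0)).exists_lipschitz
  obtain ⟨C₂, h₂, hC₂⟩ := (hφ.fderivWithin_apply (0, 1)).exists_lipschitz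
  refine ⟨C₁ + C₂, by positivity, fun x hx y hy => ?_⟩
  have hseg : segment ℝ x y ⊆ halfPlane := convex_halfPlane.segment_subset hx hy
  rw [sq, ← mul_assoc]
  refine Convex.norm_image_sub_le_of_norm_hasFDerivWithin_le'
    (f' := fderivWithin ℝ φ halfPlane) (s := segment ℝ x y)
    (fun z hz => (hφ.hasFDerivWithinAt (hseg hz)).mono hseg) (fun z hz => ?_)
    (convex_segment x y) (left_mem_segment ℝ x y) (right_mem_segment ℝ x y)
  have hzx : ‖z - x‖ ≤ ‖y - x‖ := by
    simpa [dist_eq_norm] using norm_sub_le_of_mem_segment hz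
  refine ContinuousLinearMap.opNorm_le_bound _ (by positivity) fun v => ?_
  have hv : v = v.1 • ((1 : ℝ), (0 : ℝ)) + v.2 • ((0 : ℝ), (1 : ℝ)) := by ext <;> simp
  have h1 : ‖v.1‖ ≤ ‖v‖ := norm_fst_le v
  have h2 : ‖v.2‖ ≤ ‖v‖ := norm_snd_le v
  conv_lhs => rw [hv, map_add, map_smul, map_smul]
  refine (norm_add_le _ _).trans ?_
  rw [norm_smul, norm_smul]
  have e1 := (hC₁ x hx z (hseg hz)).trans (mul_le_mul_of_nonneg_left hzx h₁)
  have e2 := (hC₂ x hx z (hseg hz)).trans (mul_le_mul_of_nonneg_left hzx h₂)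
  have := mul_le_mul h1 e1 (norm_nonneg _) (norm_nonneg _)
  have := mul_le_mul h2 e2 (norm_nonneg _) (norm_nonneg _)
  simp only [sub_apply]
  nlinarith

end IsTest

/-! ### Multiplicative convolution and its smoothness at `r = 0` -/

/-- A kernel on the plane which is integrable against all powers of `e^{-s}`. -/
def IsRapid (k : ℝ × ℝ → ℂ) : Prop :=
  ∀ j : ℕ, Integrable fun p : ℝ × ℝ => (Real.exp (-p.1) ^ j) • k p

theorem IsRapid.integrable {k : ℝ × ℝ → ℂ} (hk : IsRapid k) : Integrable k := by
  simpa using hk 0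

theorem IsRapid.exp_smul {k : ℝ × ℝ → ℂ} (hk : IsRapid k) :
    IsRapid fun p => Real.exp (-p.1) • k p := fun j => by
  simpa only [pow_succ, mul_smul] using hk (j + 1)

/-- The convolution of `φ` and `k` with respect to the group structure
`(r, t) (s, u) = (r s, t + u)`, with `k` expressed in the coordinates `(log s, u)`. -/
noncomputable def mellinConv (k φ : ℝ × ℝ → ℂ) (q : ℝ × ℝ) : ℂ :=
  ∫ p : ℝ × ℝ, φ (q.1 * Real.exp (-p.1), q.2 - p.2) * k p

theorem shift_mem_halfPlane {q : ℝ × ℝ} (hq : q ∈ halfPlane) (p : ℝ × ℝ) :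
    (q.1 * Real.exp (-p.1), q.2 - p.2) ∈ halfPlane :=
  mem_halfPlane.2 (mul_nonneg (mem_halfPlane.1 hq) (Real.exp_pos _).le)

theorem IsTest.continuous_shift {φ : ℝ × ℝ → ℂ} (hφ : IsTest φ) {q : ℝ × ℝ}
    (hq : q ∈ halfPlane) :
    Continuous fun p : ℝ × ℝ => φ (q.1 * Real.exp (-p.1), q.2 - p.2) :=
  hφ.smooth.continuousOn.comp_continuous (by fun_prop) (shift_mem_halfPlane hq)

theorem IsTest.integrable_shift {φ k : ℝ × ℝ → ℂ} (hφ : IsTest φ) (hk : Integrable k)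
    {q : ℝ × ℝ} (hq : q ∈ halfPlane) :
    Integrable fun p : ℝ × ℝ => φ (q.1 * Real.exp (-p.1), q.2 - p.2) * k p := by
  obtain ⟨C, -, hC⟩ := hφ.exists_bound
  exact hk.bdd_mul (hφ.continuous_shift hq).aestronglyMeasurable
    (Eventually.of_forall fun p => hC _ (shift_mem_halfPlane hq p))

/-- The derivative of a convolution. -/
noncomputable def mellinConvDeriv (k φ : ℝ × ℝ → ℂ) (q : ℝ × ℝ) : ℝ × ℝ →L[ℝ] ℂ :=
  (ContinuousLinearMap.fst ℝ ℝ ℝ).smulRight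
    (mellinConv (fun p => Real.exp (-p.1) • k p)
      (fun q => fderivWithin ℝ φ halfPlane q (1, 0)) q) +
  (ContinuousLinearMap.snd ℝ ℝ ℝ).smulRight
    (mellinConv k (fun q => fderivWithin ℝ φ halfPlane q (0, 1)) q)

/-- The uniform Taylor bound for `φ` is integrated against `k`. Shifting by `p` scales the
`r`-increment by `e^{-s}`, so the total error is quadratic in `y - x` as soon as `k` and `e^{-2s} k`
are integrable. -/
theorem hasFDerivWithinAt_mellinConv {φ k : ℝ × ℝ → ℂ} (hφ : IsTest φ) (hk : IsRapid k)
    {x : ℝ × ℝ} (hx : x ∈ halfPlane) :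
    HasFDerivWithinAt (mellinConv k φ) (mellinConvDeriv k φ x) halfPlane x := by
  obtain ⟨C, hC0, hC⟩ := hφ.exists_taylor_bound
  -- The shifted increment has norm at most `(1 + ε) ‖y - x‖` with `ε = e^{-s}`, and `(1 + ε)² ≤ 2
  -- (1 + ε²)`.
  set M := ∫ p : ℝ × ℝ, C * (2 * (‖k p‖ + ‖Real.exp (-p.1) ^ 2 • k p‖)) with hM
  have hMint : Integrable fun p : ℝ × ℝ => C * (2 * (‖k p‖ + ‖Real.exp (-p.1) ^ 2 • k p‖)) :=
    ((hk.integrable.norm.add (hk 2).norm).const_mul 2).const_mul C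
  have key : ∀ y ∈ halfPlane, ‖mellinConv k φ y - mellinConv k φ x -
      mellinConvDeriv k φ x (y - x)‖ ≤ M * ‖y - x‖ ^ 2 := by
    intro y hy
    have i1 := hφ.integrable_shift hk.integrable hy
    have i2 := hφ.integrable_shift hk.integrable hx
    have i3 := ((hφ.fderivWithin_apply (1, 0)).integrable_shift hk.exp_smul.integrable
      hx).smul (y - x).1
    have i4 := ((hφ.fderivWithin_apply (0, 1)).integrable_shift hk.integrable hx).smul (y - x).2
    have e : mellinConv k φ y - mellinConv k φ x - mellinConvDeriv k φ x (y - x) =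
        ∫ p : ℝ × ℝ, (φ (y.1 * Real.exp (-p.1), y.2 - p.2) * k p -
          φ (x.1 * Real.exp (-p.1), x.2 - p.2) * k p -
          ((y - x).1 • (fderivWithin ℝ φ halfPlane (x.1 * Real.exp (-p.1), x.2 - p.2) (1, 0) *
              (Real.exp (-p.1) • k p)) +
           (y - x).2 • (fderivWithin ℝ φ halfPlane (x.1 * Real.exp (-p.1), x.2 - p.2) (0, 1) *
              k p))) := by
      refine Eq.trans ?_ (integral_sub (i1.sub i2) (i3.add i4)).symm
      refine congrArg₂ _ (integral_sub i1 i2).symm ?_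
      refine Eq.trans ?_ (integral_add i3 i4).symm
      exact congrArg₂ (fun a b : ℂ => a + b)
        (integral_smul (G := ℂ) (μ := (volume : Measure (ℝ × ℝ))) (y - x).1 _).symm
        (integral_smul (G := ℂ) (μ := (volume : Measure (ℝ × ℝ))) (y - x).2 _).symm
    rw [e, hM, ← integral_mul_const]
    refine norm_integral_le_of_norm_le (hMint.mul_const _) (Eventually.of_forall fun p => ?_)
    have hT := hC _ (shift_mem_halfPlane hx p) _ (shift_mem_halfPlane hy p)
    have hpos := Real.exp_pos (-p.1)
    set ε := Real.exp (-p.1) with hε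
    set L := fderivWithin ℝ φ halfPlane (x.1 * ε, x.2 - p.2)
    have hsub : ((y.1 * ε, y.2 - p.2) : ℝ × ℝ) - (x.1 * ε, x.2 - p.2) =
        ((y - x).1 * ε) • ((1 : ℝ), (0 : ℝ)) + (y - x).2 • ((0 : ℝ), (1 : ℝ)) := by
      ext <;> simp; ring
    have hnorm : ‖((y.1 * ε, y.2 - p.2) : ℝ × ℝ) - (x.1 * ε, x.2 - p.2)‖ ≤
        ‖y - x‖ * (1 + ε) := by
      have h1 : ‖(y - x).1‖ ≤ ‖y - x‖ := norm_fst_le _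
      have h2 : ‖(y - x).2‖ ≤ ‖y - x‖ := norm_snd_le _
      have hn := norm_nonneg (y - x)
      rw [hsub]
      refine (norm_add_le _ _).trans ?_
      rw [norm_smul, norm_smul, norm_mul, Real.norm_of_nonneg hpos.le]
      have h3 := mul_le_mul_of_nonneg_right h1 hpos.le
      simp only [Prod.norm_mk, norm_one, norm_zero, max_eq_left zero_le_one,
        max_eq_right zero_le_one, mul_one]
      linarith
    have hL : L (((y.1 * ε, y.2 - p.2) : ℝ × ℝ) - (x.1 * ε, x.2 - p.2)) =
        ((y - x).1 * ε) • L (1, 0) + (y - x).2 • L (0, 1) := by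
      rw [hsub, map_add, map_smul, map_smul]
    have e2 : φ (y.1 * ε, y.2 - p.2) * k p - φ (x.1 * ε, x.2 - p.2) * k p -
          ((y - x).1 • (L (1, 0) * (ε • k p)) + (y - x).2 • (L (0, 1) * k p)) =
        (φ (y.1 * ε, y.2 - p.2) - φ (x.1 * ε, x.2 - p.2) -
          L (((y.1 * ε, y.2 - p.2) : ℝ × ℝ) - (x.1 * ε, x.2 - p.2))) * k p := by
      rw [hL]
      simp only [Complex.real_smul]
      push_cast
      ring
    rw [e2, norm_mul, norm_smul, norm_pow, Real.norm_of_nonneg hpos.le]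
    have h3 : ‖((y.1 * ε, y.2 - p.2) : ℝ × ℝ) - (x.1 * ε, x.2 - p.2)‖ ^ 2 ≤
        (‖y - x‖ * (1 + ε)) ^ 2 := pow_le_pow_left₀ (norm_nonneg _) hnorm 2
    have h4 : (‖y - x‖ * (1 + ε)) ^ 2 ≤ 2 * (1 + ε ^ 2) * ‖y - x‖ ^ 2 := by
      nlinarith [mul_nonneg (sq_nonneg (1 - ε)) (sq_nonneg ‖y - x‖)]
    calc _ ≤ C * (2 * (1 + ε ^ 2) * ‖y - x‖ ^ 2) * ‖k p‖ :=
          mul_le_mul_of_nonneg_right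
            (hT.trans (mul_le_mul_of_nonneg_left (h3.trans h4) hC0)) (norm_nonneg _)
      _ = _ := by ring
  refine HasFDerivWithinAt.of_isLittleO ?_
  have hO : (fun y => mellinConv k φ y - mellinConv k φ x - mellinConvDeriv k φ x (y - x))
      =O[𝓝[halfPlane] x] fun y => ‖y - x‖ ^ 2 :=
    Asymptotics.IsBigO.of_bound M (by
      filter_upwards [self_mem_nhdsWithin] with y hy
      rw [norm_pow, norm_norm]
      exact key y hy)
  refine hO.trans_isLittleO ?_
  have := (Asymptotics.isLittleO_pow_sub_pow_sub x (one_lt_two)).mono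
    (nhdsWithin_le_nhds (s := halfPlane))
  simpa using this

/-- Both partial derivatives are again convolutions of a test function with a rapid kernel: `∂φ/∂r`
with `e^{-s} k`, and `∂φ/∂t` with `k`. Hence the induction runs over all pairs `φ`, `k` at once. -/
theorem contDiffOn_mellinConv {φ k : ℝ × ℝ → ℂ} (hφ : IsTest φ) (hk : IsRapid k) :
    ContDiffOn ℝ ∞ (mellinConv k φ) halfPlane := by
  refine contDiffOn_infty.2 fun n => ?_
  induction n generalizing φ k with
  | zero =>
    exact contDiffOn_zero.2 fun x hx => (hasFDerivWithinAt_mellinConv hφ hk hx).continuousWithinAt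
  | succ n ih =>
    push_cast
    refine (contDiffOn_succ_iff_fderivWithin uniqueDiffOn_halfPlane).2
      ⟨fun x hx => (hasFDerivWithinAt_mellinConv hφ hk hx).differentiableWithinAt, by simp, ?_⟩
    refine ContDiffOn.congr (f := mellinConvDeriv k φ) ?_ fun x hx =>
      (hasFDerivWithinAt_mellinConv hφ hk hx).fderivWithin (uniqueDiffOn_halfPlane x hx)
    exact (contDiffOn_const.smulRight (ih (hφ.fderivWithin_apply _) hk.exp_smul)).add
      (contDiffOn_const.smulRight (ih (hφ.fderivWithin_apply _) hk))

/-! ### The Gaussian Cauchy kernel -/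

/-- The point `s + i t` of the plane. -/
noncomputable def toComplex (p : ℝ × ℝ) : ℂ := p.1 + p.2 * Complex.I

/-- The Cauchy kernel `1 / ζ`, multiplied by `e^{-ζ²}` and cut off to the strip `|Im ζ| < M`. -/
noncomputable def gaussCauchyKernel (M : ℝ) (p : ℝ × ℝ) : ℂ :=
  if |p.2| < M then Complex.exp (-toComplex p ^ 2) / toComplex p else 0

theorem measurable_gaussCauchyKernel (M : ℝ) : Measurable (gaussCauchyKernel M) := by
  unfold gaussCauchyKernel toComplex
  exact Measurable.ite (measurableSet_lt (by fun_prop) measurable_const) (by fun_prop)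
    measurable_const

theorem norm_exp_neg_sq (p : ℝ × ℝ) :
    ‖Complex.exp (-toComplex p ^ 2)‖ = Real.exp (p.2 ^ 2 - p.1 ^ 2) := by
  rw [Complex.norm_exp]
  congr 1
  simp [toComplex, sq]

theorem sq_norm_toComplex (p : ℝ × ℝ) : ‖toComplex p‖ ^ 2 = p.1 ^ 2 + p.2 ^ 2 := by
  rw [Complex.sq_norm, toComplex, Complex.normSq_add_mul_I]

theorem integrable_abs_rpow_mul_exp_neg_sq :
    Integrable fun x : ℝ => |x| ^ (-(1 / 2) : ℝ) * Real.exp (-(1 / 2) * x ^ 2) := by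
  have h := integrable_rpow_mul_exp_neg_mul_sq (b := 1 / 2) (by norm_num) (s := -(1 / 2))
    (by norm_num)
  refine (h.norm.add h.comp_neg.norm).mono' ?_ (Eventually.of_forall fun x => ?_)
  · exact Measurable.aestronglyMeasurable (by fun_prop)
  · simp only [Pi.add_apply]
    rw [Real.norm_of_nonneg (by positivity)]
    rcases le_total 0 x with hx | hx
    · rw [abs_of_nonneg hx]
      exact (le_abs_self _).trans (le_add_of_nonneg_right (norm_nonneg _))
    · rw [abs_of_nonpos hx]
      refine le_trans ?_ (le_add_of_nonneg_left (norm_nonneg _))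
      rw [neg_sq]
      exact le_abs_self _

/-- From `|ζ|² ≥ |s| |u|`. The singularity is thus dominated by a product of integrable one-variable
singularities, and integrability of the kernel reduces to one dimension. -/
theorem norm_inv_toComplex_le {p : ℝ × ℝ} (h1 : p.1 ≠ 0) (h2 : p.2 ≠ 0) :
    ‖toComplex p‖⁻¹ ≤ |p.1| ^ (-(1 / 2) : ℝ) * |p.2| ^ (-(1 / 2) : ℝ) := by
  have a1 := abs_pos.2 h1
  have a2 := abs_pos.2 h2
  rw [← Real.mul_rpow a1.le a2.le, Real.rpow_neg (by positivity), ← Real.sqrt_eq_rpow]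
  refine inv_anti₀ (Real.sqrt_pos.2 (by positivity)) ?_
  refine Real.sqrt_le_iff.2 ⟨norm_nonneg _, ?_⟩
  rw [sq_norm_toComplex, ← sq_abs p.1, ← sq_abs p.2]
  nlinarith [sq_nonneg (|p.1| - |p.2|)]

theorem isRapid_gaussCauchyKernel (M : ℝ) : IsRapid (gaussCauchyKernel M) := fun j => by
  have hint := (integrable_abs_rpow_mul_exp_neg_sq.mul_prod
    integrable_abs_rpow_mul_exp_neg_sq).const_mul (Real.exp ((j : ℝ) ^ 2 + 2 * M ^ 2))
  refine hint.mono' ?_ ?_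
  · exact ((by fun_prop : Measurable fun p : ℝ × ℝ => Real.exp (-p.1) ^ j).smul
      (measurable_gaussCauchyKernel M)).aestronglyMeasurable
  -- On the axes the majorant takes the default value `0 ^ (-1/2) = 0`, so the estimate is only
  -- available off this null set.
  have n1 : ∀ᵐ p : ℝ × ℝ, p.1 ≠ 0 :=
    Measure.quasiMeasurePreserving_fst.ae (Measure.ae_ne volume 0)
  have n2 : ∀ᵐ p : ℝ × ℝ, p.2 ≠ 0 :=
    Measure.quasiMeasurePreserving_snd.ae (Measure.ae_ne volume 0)
  filter_upwards [n1, n2] with p h1 h2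
  rw [gaussCauchyKernel]
  split_ifs with hM
  · rw [norm_smul, norm_div, norm_exp_neg_sq, div_eq_mul_inv, norm_pow, Real.norm_eq_abs,
      Real.abs_exp, ← Real.exp_nat_mul, ← mul_assoc, ← Real.exp_add]
    have e : Real.exp (j * -p.1 + (p.2 ^ 2 - p.1 ^ 2)) ≤ Real.exp ((j : ℝ) ^ 2 + 2 * M ^ 2) *
        (Real.exp (-(1 / 2) * p.1 ^ 2) * Real.exp (-(1 / 2) * p.2 ^ 2)) := by
      rw [← Real.exp_add, ← Real.exp_add]
      refine Real.exp_le_exp.2 ?_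
      have : p.2 ^ 2 ≤ M ^ 2 := by
        rw [← sq_abs p.2]
        exact pow_le_pow_left₀ (abs_nonneg _) hM.le 2
      nlinarith [sq_nonneg (j + p.1)]
    refine (mul_le_mul e (norm_inv_toComplex_le h1 h2) (by positivity) (by positivity)).trans
      (le_of_eq ?_)
    ring
  · rw [smul_zero, norm_zero]
    positivity

/-! ### The Cauchy–Pompeiu formula in polar coordinates -/

/-- The real-linear map with partial derivatives `a` and `b`. -/
noncomputable def ofPartials (a b : ℂ) : ℝ × ℝ →L[ℝ] ℂ :=
  (ContinuousLinearMap.fst ℝ ℝ ℝ).smulRight a + (ContinuousLinearMap.snd ℝ ℝ ℝ).smulRight b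

@[simp]
theorem ofPartials_apply (a b : ℂ) (v : ℝ × ℝ) : ofPartials a b v = v.1 * a + v.2 * b := by
  simp [ofPartials]

theorem hasDerivAt_radial {h A B : ℝ × ℝ → ℂ}
    (hd : ∀ p, HasFDerivAt h (ofPartials (A p) (B p)) p) (ρ θ : ℝ) :
    HasDerivAt (fun ρ : ℝ => h (ρ * Real.cos θ, ρ * Real.sin θ))
      (Real.cos θ * A (ρ * Real.cos θ, ρ * Real.sin θ) +
        Real.sin θ * B (ρ * Real.cos θ, ρ * Real.sin θ)) ρ := by
  have h1 : HasDerivAt (fun ρ : ℝ => (ρ * Real.cos θ, ρ * Real.sin θ))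
      (Real.cos θ, Real.sin θ) ρ :=
    (by simpa using (hasDerivAt_id ρ).mul_const (Real.cos θ) :
      HasDerivAt (fun ρ : ℝ => ρ * Real.cos θ) (Real.cos θ) ρ).prodMk
    (by simpa using (hasDerivAt_id ρ).mul_const (Real.sin θ) :
      HasDerivAt (fun ρ : ℝ => ρ * Real.sin θ) (Real.sin θ) ρ)
  have := (hd (ρ * Real.cos θ, ρ * Real.sin θ)).comp_hasDerivAt ρ h1
  rwa [ofPartials_apply] at this

theorem hasDerivAt_angular {h A B : ℝ × ℝ → ℂ}
    (hd : ∀ p, HasFDerivAt h (ofPartials (A p) (B p)) p) (ρ θ : ℝ) :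
    HasDerivAt (fun θ : ℝ => h (ρ * Real.cos θ, ρ * Real.sin θ))
      (ρ * (Real.cos θ * B (ρ * Real.cos θ, ρ * Real.sin θ) -
        Real.sin θ * A (ρ * Real.cos θ, ρ * Real.sin θ))) θ := by
  have h1 : HasDerivAt (fun θ : ℝ => (ρ * Real.cos θ, ρ * Real.sin θ))
      (ρ * -Real.sin θ, ρ * Real.cos θ) θ :=
    ((Real.hasDerivAt_cos θ).const_mul ρ).prodMk ((Real.hasDerivAt_sin θ).const_mul ρ)
  have := (hd (ρ * Real.cos θ, ρ * Real.sin θ)).comp_hasDerivAt θ h1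
  rw [ofPartials_apply] at this
  refine HasDerivAt.congr_deriv this ?_
  push_cast
  ring

theorem integrableOn_polar_of_gaussian_bound {F : ℝ × ℝ → ℂ} (hF : Continuous F) {C b : ℝ}
    (hb : 0 < b) (hbound : ∀ q : ℝ × ℝ, ‖F q‖ ≤ C * Real.exp (-b * q.1 ^ 2)) :
    IntegrableOn F (Ioi 0 ×ˢ Ioo (-Real.pi) Real.pi) := by
  have h1 : Integrable (fun ρ : ℝ => C * Real.exp (-b * ρ ^ 2)) (volume.restrict (Ioi 0)) :=
    ((integrable_exp_neg_mul_sq hb).const_mul C).restrict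
  have h2 : Integrable (fun _ : ℝ => (1 : ℝ)) (volume.restrict (Ioo (-Real.pi) Real.pi)) :=
    integrable_const _
  have h3 := h1.mul_prod h2
  rw [Measure.prod_restrict] at h3
  exact h3.mono' hF.aestronglyMeasurable (Eventually.of_forall fun q => by simpa using hbound q)

/-- The Cauchy–Pompeiu formula at the origin, for rapidly decreasing functions. -/
theorem integral_dbar_div {h A B : ℝ × ℝ → ℂ}
    (hd : ∀ p, HasFDerivAt h (ofPartials (A p) (B p)) p) (hA : Continuous A) (hB : Continuous B)
    {C b : ℝ} (hb : 0 < b) (hC : ∀ p : ℝ × ℝ, ‖h p‖ ≤ C * Real.exp (-b * (p.1 ^ 2 + p.2 ^ 2)))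
    (hAC : ∀ p : ℝ × ℝ, ‖A p‖ ≤ C * Real.exp (-b * (p.1 ^ 2 + p.2 ^ 2)))
    (hBC : ∀ p : ℝ × ℝ, ‖B p‖ ≤ C * Real.exp (-b * (p.1 ^ 2 + p.2 ^ 2))) :
    ∫ p, (A p + Complex.I * B p) / toComplex p = -(2 * Real.pi) * h 0 := by
  have hsq : ∀ ρ θ : ℝ, (ρ * Real.cos θ) ^ 2 + (ρ * Real.sin θ) ^ 2 = ρ ^ 2 := fun ρ θ => by
    rw [mul_pow, mul_pow, ← mul_add, Real.cos_sq_add_sin_sq, mul_one]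
  -- `a` is the radial derivative of `h`, and `ρ c` its angular derivative. The Jacobian `ρ` cancels
  -- the pole, turning the integrand into `a + i c`. Along each ray `a` integrates to `-h 0`, while
  -- on each circle `c` integrates to `0` by periodicity.
  set a : ℝ × ℝ → ℂ := fun q => Real.cos q.2 * A (q.1 * Real.cos q.2, q.1 * Real.sin q.2) +
    Real.sin q.2 * B (q.1 * Real.cos q.2, q.1 * Real.sin q.2) with ha
  set c : ℝ × ℝ → ℂ := fun q => Real.cos q.2 * B (q.1 * Real.cos q.2, q.1 * Real.sin q.2) -
    Real.sin q.2 * A (q.1 * Real.cos q.2, q.1 * Real.sin q.2) with hc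
  have hmul : ∀ (x : ℝ) (z : ℂ) (D : ℝ), |x| ≤ 1 → ‖z‖ ≤ D → ‖(x : ℂ) * z‖ ≤ D := by
    intro x z D hx hz
    rw [norm_mul, Complex.norm_real, Real.norm_eq_abs]
    exact (mul_le_of_le_one_left (norm_nonneg _) hx).trans hz
  have ha_int : IntegrableOn a (Ioi 0 ×ˢ Ioo (-Real.pi) Real.pi) := by
    refine integrableOn_polar_of_gaussian_bound (by fun_prop) hb (C := C + C) fun q => ?_
    rw [add_mul, ← hsq q.1 q.2]
    exact (norm_add_le _ _).trans (add_le_add (hmul _ _ _ (Real.abs_cos_le_one _) (hAC _))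
      (hmul _ _ _ (Real.abs_sin_le_one _) (hBC _)))
  have hc_int : IntegrableOn c (Ioi 0 ×ˢ Ioo (-Real.pi) Real.pi) := by
    refine integrableOn_polar_of_gaussian_bound (by fun_prop) hb (C := C + C) fun q => ?_
    rw [add_mul, ← hsq q.1 q.2]
    exact (norm_sub_le _ _).trans (add_le_add (hmul _ _ _ (Real.abs_cos_le_one _) (hBC _))
      (hmul _ _ _ (Real.abs_sin_le_one _) (hAC _)))
  have hrad : ∫ q in Ioi 0 ×ˢ Ioo (-Real.pi) Real.pi, a q = -(2 * Real.pi) * h 0 := by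
    rw [Measure.volume_eq_prod, ← Measure.prod_restrict, integral_prod_symm _ (by
      rw [Measure.prod_restrict]; exact ha_int)]
    have hray : ∀ θ : ℝ, ∫ ρ in Ioi (0 : ℝ), a (ρ, θ) = 0 - h 0 := by
      intro θ
      have hg := (integrable_exp_neg_mul_sq hb).const_mul (C + C)
      have hlim : Tendsto (fun ρ : ℝ => h (ρ * Real.cos θ, ρ * Real.sin θ)) atTop (𝓝 0) := by
        have hlim0 : Tendsto (fun ρ : ℝ => C * Real.exp (-b * ρ ^ 2)) atTop (𝓝 0) := by
          rw [← mul_zero C]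
          refine (Real.tendsto_exp_atBot.comp ?_).const_mul C
          exact (tendsto_pow_atTop two_ne_zero).const_mul_atTop_of_neg (neg_neg_of_pos hb)
        refine squeeze_zero_norm (fun ρ => ?_) hlim0
        rw [← hsq ρ θ]
        exact hC _
      have := integral_Ioi_of_hasDerivAt_of_tendsto (a := 0)
        (f := fun ρ : ℝ => h (ρ * Real.cos θ, ρ * Real.sin θ)) (f' := fun ρ => a (ρ, θ))
        (hasDerivAt_radial hd 0 θ).continuousAt.continuousWithinAt
        (fun ρ _ => hasDerivAt_radial hd ρ θ) ?_ hlim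
      · rw [this]
        simp only [zero_mul]
        rfl
      · refine (hg.mono' (by fun_prop) (Eventually.of_forall fun ρ => ?_)).integrableOn
        rw [add_mul, ← hsq ρ θ]
        exact (norm_add_le _ _).trans (add_le_add (hmul _ _ _ (Real.abs_cos_le_one _) (hAC _))
          (hmul _ _ _ (Real.abs_sin_le_one _) (hBC _)))
    simp_rw [hray]
    rw [setIntegral_const, Measure.real, Real.volume_Ioo, ENNReal.toReal_ofReal (by
      linarith [Real.pi_pos]), Complex.real_smul]
    push_cast
    ring
  have hang : ∫ q in Ioi 0 ×ˢ Ioo (-Real.pi) Real.pi, c q = 0 := by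
    rw [Measure.volume_eq_prod, setIntegral_prod _ hc_int]
    refine setIntegral_eq_zero_of_forall_eq_zero fun ρ (hρ : 0 < ρ) => ?_
    have h1 : ∫ θ in (-Real.pi)..Real.pi, (ρ : ℂ) * c (ρ, θ) = 0 := by
      rw [intervalIntegral.integral_eq_sub_of_hasDerivAt
        (fun θ _ => hasDerivAt_angular hd ρ θ)
        (Continuous.intervalIntegrable (by fun_prop) _ _)]
      simp
    rw [intervalIntegral.integral_const_mul] at h1
    have h2 := (mul_eq_zero.1 h1).resolve_left (by exact_mod_cast hρ.ne')
    rwa [intervalIntegral.integral_of_le (by linarith [Real.pi_pos]),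
      integral_Ioc_eq_integral_Ioo] at h2
  rw [← integral_comp_polarCoord_symm, polarCoord_target]
  have hcongr : ∀ q ∈ Ioi (0 : ℝ) ×ˢ Ioo (-Real.pi) Real.pi,
      q.1 • ((A (polarCoord.symm q) + Complex.I * B (polarCoord.symm q)) /
        toComplex (polarCoord.symm q)) = a q + Complex.I * c q := by
    rintro ⟨ρ, θ⟩ ⟨hρ, -⟩
    have hρ' : (ρ : ℂ) ≠ 0 := by exact_mod_cast (ne_of_gt hρ)
    have hcs : (Real.cos θ : ℂ) ^ 2 + (Real.sin θ : ℂ) ^ 2 = 1 := by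
      exact_mod_cast Real.cos_sq_add_sin_sq θ
    simp only [polarCoord_symm_apply, ha, hc, toComplex, Complex.real_smul]
    generalize A _ = x
    generalize B _ = y
    generalize Real.cos θ = u at *
    generalize Real.sin θ = v at *
    push_cast
    have hprod : ((u : ℂ) - v * Complex.I) * (u + v * Complex.I) = 1 := by
      linear_combination hcs - (v : ℂ) ^ 2 * Complex.I_mul_I
    have hne : (u : ℂ) + v * Complex.I ≠ 0 := right_ne_zero_of_mul_eq_one hprod
    have hz : (ρ : ℂ) * u + ρ * v * Complex.I = ρ * (u + v * Complex.I) := by ring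
    rw [hz, mul_div_assoc', mul_div_mul_left _ _ hρ', div_eq_iff hne]
    linear_combination (-(x + Complex.I * y)) * hprod +
      (-(v : ℂ) * y * (u + v * Complex.I)) * Complex.I_mul_I
  rw [setIntegral_congr_fun (measurableSet_Ioi.prod measurableSet_Ioo) hcongr,
    integral_add ha_int (hc_int.const_mul _), integral_const_mul, hang, hrad]
  ring

/-! ### The convolution solves the polar `∂̄`-equation -/

theorem ofPartials_partials (L : ℝ × ℝ →L[ℝ] ℂ) : ofPartials (L (1, 0)) (L (0, 1)) = L := by
  ext <;> simp

theorem fderivWithin_eq_zero_of_eqOn_zero {φ : ℝ × ℝ → ℂ} {O : Set (ℝ × ℝ)} (hO : IsOpen O)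
    (h : ∀ p ∈ halfPlane, p ∈ O → φ p = 0) {p : ℝ × ℝ} (hp : p ∈ halfPlane) (hpO : p ∈ O) :
    fderivWithin ℝ φ halfPlane p = 0 := by
  have h0 : φ =ᶠ[𝓝[halfPlane] p] fun _ => 0 := by
    filter_upwards [self_mem_nhdsWithin, mem_nhdsWithin_of_mem_nhds (hO.mem_nhds hpO)] with y hy hyO
    exact h y hy hyO
  rw [h0.fderivWithin_eq (h p hp hpO)]
  simp

theorem hasFDerivAt_toComplex (p : ℝ × ℝ) :
    HasFDerivAt toComplex (ofPartials 1 Complex.I) p := by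
  have : toComplex = ofPartials 1 Complex.I := by
    funext p; simp [toComplex]
  rw [this]
  exact (ofPartials 1 Complex.I).hasFDerivAt

theorem hasFDerivAt_exp_neg_sq (p : ℝ × ℝ) :
    HasFDerivAt (fun p => Complex.exp (-toComplex p ^ 2))
      (ofPartials (-(2 * toComplex p) * Complex.exp (-toComplex p ^ 2))
        (-(2 * Complex.I * toComplex p) * Complex.exp (-toComplex p ^ 2))) p := by
  have h := ((hasFDerivAt_toComplex p).pow 2).neg.cexp
  refine h.congr_fderiv (ContinuousLinearMap.ext fun v => ?_)
  simp
  ring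

/-- For `r > 0` all shifted points stay in the open half plane, where one-sided derivatives are
honest ones and the chain rule applies. -/
theorem IsTest.hasFDerivAt_shift {φ : ℝ × ℝ → ℂ} (hφ : IsTest φ) {q : ℝ × ℝ} (hq : 0 < q.1)
    (p : ℝ × ℝ) :
    HasFDerivAt (fun p : ℝ × ℝ => φ (q.1 * Real.exp (-p.1), q.2 - p.2))
      (ofPartials
        (-(q.1 * Real.exp (-p.1) *
          fderivWithin ℝ φ halfPlane (q.1 * Real.exp (-p.1), q.2 - p.2) (1, 0)))
        (-fderivWithin ℝ φ halfPlane (q.1 * Real.exp (-p.1), q.2 - p.2) (0, 1))) p := by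
  have h1 : HasFDerivAt (fun p : ℝ × ℝ => q.1 * Real.exp (-p.1)) _ p :=
    ((hasFDerivAt_fst (𝕜 := ℝ) (p := p)).neg.exp).const_mul q.1
  have h2 : HasFDerivAt (fun p : ℝ × ℝ => q.2 - p.2) _ p :=
    (hasFDerivAt_snd (𝕜 := ℝ) (p := p)).const_sub q.2
  have hpos : 0 < q.1 * Real.exp (-p.1) := mul_pos hq (Real.exp_pos _)
  have h3 := (hφ.hasFDerivWithinAt (q := (q.1 * Real.exp (-p.1), q.2 - p.2))
    (mem_halfPlane.2 hpos.le)).hasFDerivAt (halfPlane_mem_nhds hpos)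
  have h4 := h3.comp p (h1.prodMk h2)
  refine h4.congr_fderiv (ContinuousLinearMap.ext fun v => ?_)
  rw [← ofPartials_partials (fderivWithin ℝ φ halfPlane _)]
  simp
  ring

/-- The factors `1`, `e^{-s}` and `|ζ|` are those multiplying the Gaussian in `h`, `A` and `B` when
Cauchy–Pompeiu is applied. On the strip `|e^{-ζ²}| = e^{u² - s²}` absorbs each of them, leaving
Gaussian decay in both variables. -/
theorem exp_bounds {M : ℝ} {p : ℝ × ℝ} (hp : |p.2| ≤ M) :
    ‖Complex.exp (-toComplex p ^ 2)‖ ≤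
        Real.exp (2 * M ^ 2 + 1) * Real.exp (-(1 / 4) * (p.1 ^ 2 + p.2 ^ 2)) ∧
      Real.exp (-p.1) * ‖Complex.exp (-toComplex p ^ 2)‖ ≤
        Real.exp (2 * M ^ 2 + 1) * Real.exp (-(1 / 4) * (p.1 ^ 2 + p.2 ^ 2)) ∧
      ‖toComplex p‖ * ‖Complex.exp (-toComplex p ^ 2)‖ ≤
        Real.exp (2 * M ^ 2 + 1) * Real.exp (-(1 / 4) * (p.1 ^ 2 + p.2 ^ 2)) := by
  have h2 : p.2 ^ 2 ≤ M ^ 2 := by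
    rw [← sq_abs p.2]
    exact pow_le_pow_left₀ (abs_nonneg _) hp 2
  have hz : ‖toComplex p‖ ≤ Real.exp ((p.1 ^ 2 + p.2 ^ 2) / 2) := by
    rw [← sq_norm_toComplex]
    have := Real.add_one_le_exp (‖toComplex p‖ ^ 2 / 2)
    nlinarith [sq_nonneg (‖toComplex p‖ - 1)]
  rw [norm_exp_neg_sq, ← Real.exp_add, ← Real.exp_add]
  refine ⟨Real.exp_le_exp.2 (by nlinarith), Real.exp_le_exp.2 ?_,
    (mul_le_mul_of_nonneg_right hz (Real.exp_pos _).le).trans ?_⟩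
  · nlinarith [sq_nonneg (p.1 + 1)]
  · rw [← Real.exp_add]
    exact Real.exp_le_exp.2 (by nlinarith)

/-- Convolution with the Gaussian Cauchy kernel inverts `(r ∂/∂r + i ∂/∂t) / 2π`. -/
theorem mellinConv_gaussCauchyKernel {φ : ℝ × ℝ → ℂ} (hφ : IsTest φ) {M M' : ℝ} (hM : M' < M)
    {q : ℝ × ℝ} (hq : 0 < q.1) (hs : ∀ p ∈ halfPlane, M' ≤ |q.2 - p.2| → φ p = 0) :
    q.1 * fderivWithin ℝ (mellinConv (gaussCauchyKernel M) φ) halfPlane q (1, 0) +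
      Complex.I * fderivWithin ℝ (mellinConv (gaussCauchyKernel M) φ) halfPlane q (0, 1) =
        2 * Real.pi * φ q := by
  have hqS : q ∈ halfPlane := mem_halfPlane.2 hq.le
  have hk := isRapid_gaussCauchyKernel M
  have hr := hφ.fderivWithin_apply (1, 0)
  have ht := hφ.fderivWithin_apply (0, 1)
  set φr := fun p => fderivWithin ℝ φ halfPlane p (1, 0) with hφr
  set φt := fun p => fderivWithin ℝ φ halfPlane p (0, 1) with hφt
  set σ : ℝ × ℝ → ℝ × ℝ := fun p => (q.1 * Real.exp (-p.1), q.2 - p.2) with hσ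
  set E : ℝ × ℝ → ℂ := fun p => Complex.exp (-toComplex p ^ 2) with hE
  have hσS : ∀ p, σ p ∈ halfPlane := shift_mem_halfPlane hqS
  have hσ2 : ∀ p : ℝ × ℝ, |q.2 - (σ p).2| = |p.2| := fun p => by simp [hσ]
  -- The strict inequality is an open condition, so derivatives vanish too. As `M' < M`, this covers
  -- all points where the kernel is cut off, and the truncation is invisible in the integrals below.
  have hzero : ∀ p : ℝ × ℝ, M' < |p.2| → φ (σ p) = 0 ∧ φr (σ p) = 0 ∧ φt (σ p) = 0 := by
    intro p hp
    have hO : IsOpen {x : ℝ × ℝ | M' < |q.2 - x.2|} := isOpen_lt (by fun_prop) (by fun_prop)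
    have h0 := fderivWithin_eq_zero_of_eqOn_zero (φ := φ) hO (fun x hx hxO => hs x hx (le_of_lt hxO))
      (hσS p) (show M' < |q.2 - (σ p).2| by rwa [hσ2])
    exact ⟨hs _ (hσS p) (by rw [hσ2]; exact hp.le), by simp [hφr, h0], by simp [hφt, h0]⟩
  -- The partial derivatives of `φ(σ p) E p`. The terms with `2 ζ φ` cancel in `A + i B` because `E`
  -- is holomorphic.
  set A : ℝ × ℝ → ℂ := fun p =>
    -(q.1 * Real.exp (-p.1) * φr (σ p) + 2 * toComplex p * φ (σ p)) * E p with hA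
  set B : ℝ × ℝ → ℂ := fun p =>
    -(φt (σ p) + 2 * Complex.I * toComplex p * φ (σ p)) * E p with hB
  have hd : ∀ p, HasFDerivAt (fun p => φ (σ p) * E p) (ofPartials (A p) (B p)) p := fun p => by
    refine ((hφ.hasFDerivAt_shift hq p).mul (hasFDerivAt_exp_neg_sq p)).congr_fderiv
      (ContinuousLinearMap.ext fun v => ?_)
    simp [hA, hB, hE, hσ, hφr, hφt]
    ring
  have c1 : Continuous fun p => φ (σ p) := hφ.continuous_shift hqS
  have c2 : Continuous fun p => φr (σ p) := hr.continuous_shift hqS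
  have c3 : Continuous fun p => φt (σ p) := ht.continuous_shift hqS
  have c4 : Continuous toComplex := by unfold toComplex; fun_prop
  have cE : Continuous E := Complex.continuous_exp.comp (c4.pow 2).neg
  have c5 : Continuous fun p : ℝ × ℝ => (q.1 : ℂ) * (Real.exp (-p.1) : ℂ) := by fun_prop
  have cA : Continuous A := ((c5.mul c2).add ((continuous_const.mul c4).mul c1)).neg.mul cE
  have cB : Continuous B := (c3.add ((continuous_const.mul c4).mul c1)).neg.mul cE
  obtain ⟨K₁, k₁, hK₁⟩ := hφ.exists_bound
  obtain ⟨K₂, k₂, hK₂⟩ := hr.exists_bound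
  obtain ⟨K₃, k₃, hK₃⟩ := ht.exists_bound
  set K := K₁ + K₂ + K₃ with hK
  set G : ℝ × ℝ → ℝ := fun p =>
    Real.exp (2 * M' ^ 2 + 1) * Real.exp (-(1 / 4) * (p.1 ^ 2 + p.2 ^ 2)) with hG
  have hbound : ∀ p : ℝ × ℝ, ‖φ (σ p) * E p‖ ≤ (K * (q.1 + 3)) * G p ∧
      ‖A p‖ ≤ (K * (q.1 + 3)) * G p ∧ ‖B p‖ ≤ (K * (q.1 + 3)) * G p := by
    intro p
    have hG0 : 0 < G p := by positivity
    have hK0 : 0 ≤ K := by positivity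
    rcases le_or_gt |p.2| M' with hp | hp
    · obtain ⟨b1, b2, b3⟩ := exp_bounds hp
      have e1 : ‖φ (σ p)‖ ≤ K := (hK₁ _ (hσS p)).trans (by rw [hK]; linarith)
      have e2 : ‖φr (σ p)‖ ≤ K := (hK₂ _ (hσS p)).trans (by rw [hK]; linarith)
      have e3 : ‖φt (σ p)‖ ≤ K := (hK₃ _ (hσS p)).trans (by rw [hK]; linarith)
      have f1 : ‖φ (σ p)‖ * ‖E p‖ ≤ K * G p := mul_le_mul e1 b1 (norm_nonneg _) hK0
      have f2 : ‖φr (σ p)‖ * (Real.exp (-p.1) * ‖E p‖) ≤ K * G p :=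
        mul_le_mul e2 b2 (by positivity) hK0
      have f3 : ‖φ (σ p)‖ * (‖toComplex p‖ * ‖E p‖) ≤ K * G p :=
        mul_le_mul e1 b3 (by positivity) hK0
      have f4 : ‖φt (σ p)‖ * ‖E p‖ ≤ K * G p := mul_le_mul e3 b1 (norm_nonneg _) hK0
      have f5 := mul_le_mul_of_nonneg_left f2 hq.le
      have hKG : 0 ≤ K * G p := mul_nonneg hK0 hG0.le
      have hqKG := mul_nonneg hq.le hKG
      refine ⟨?_, ?_, ?_⟩
      · rw [norm_mul]
        linarith
      · rw [hA]
        simp only [neg_mul, norm_neg, norm_mul]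
        refine (mul_le_mul_of_nonneg_right (norm_add_le _ _) (norm_nonneg _)).trans ?_
        simp only [norm_mul, Complex.norm_real, Real.norm_eq_abs, Real.abs_exp, abs_of_pos hq,
          Complex.norm_ofNat]
        linarith
      · rw [hB]
        simp only [neg_mul, norm_neg, norm_mul]
        refine (mul_le_mul_of_nonneg_right (norm_add_le _ _) (norm_nonneg _)).trans ?_
        simp only [norm_mul, Complex.norm_I, Complex.norm_ofNat]
        linarith
    · obtain ⟨z1, z2, z3⟩ := hzero p hp
      have hn : 0 ≤ (K * (q.1 + 3)) * G p := by positivity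
      simp only [hA, hB, z1, z2, z3]
      simpa using hn
  have hpomp := integral_dbar_div hd cA cB
    (C := K * (q.1 + 3) * Real.exp (2 * M' ^ 2 + 1)) (b := 1 / 4) (by norm_num)
    (fun p => by rw [mul_assoc]; exact (hbound p).1)
    (fun p => by rw [mul_assoc]; exact (hbound p).2.1)
    (fun p => by rw [mul_assoc]; exact (hbound p).2.2)
  have hD := (hasFDerivWithinAt_mellinConv hφ hk hqS).fderivWithin (uniqueDiffOn_halfPlane q hqS)
  have i1 := (hr.integrable_shift hk.exp_smul.integrable hqS).const_mul (q.1 : ℂ)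
  have i2 := (ht.integrable_shift hk.integrable hqS).const_mul Complex.I
  have hval : q.1 * fderivWithin ℝ (mellinConv (gaussCauchyKernel M) φ) halfPlane q (1, 0) +
      Complex.I * fderivWithin ℝ (mellinConv (gaussCauchyKernel M) φ) halfPlane q (0, 1) =
      ∫ p, (q.1 * (φr (σ p) * (Real.exp (-p.1) • gaussCauchyKernel M p)) +
        Complex.I * (φt (σ p) * gaussCauchyKernel M p)) := by
    rw [hD, integral_add i1 i2, integral_const_mul, integral_const_mul]
    simp [mellinConvDeriv, mellinConv, hφr, hφt]
  have hneg : (fun p => (A p + Complex.I * B p) / toComplex p) = fun p =>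
      -(q.1 * (φr (σ p) * (Real.exp (-p.1) • gaussCauchyKernel M p)) +
        Complex.I * (φt (σ p) * gaussCauchyKernel M p)) := by
    funext p
    rw [gaussCauchyKernel]
    split_ifs with hp
    · simp only [hA, hB, Complex.real_smul, hE]
      ring_nf
      simp only [Complex.I_sq]
      ring
    · obtain ⟨z1, z2, z3⟩ := hzero p (hM.trans_le (not_lt.1 hp))
      simp [hA, hB, z1, z2, z3]
  rw [hneg, integral_neg] at hpomp
  rw [hval, neg_eq_iff_eq_neg.1 hpomp]
  have h0 : σ 0 = q := by simp [hσ]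
  rw [h0]
  simp [hE, toComplex]

theorem exists_polar_solution {φ : ℝ × ℝ → ℂ} (hφ : IsTest φ) {t₀ δ : ℝ}
    (hs : ∀ p ∈ halfPlane, δ ≤ |p.2 - t₀| → φ p = 0) :
    ∃ F : ℝ × ℝ → ℂ, ContDiffOn ℝ ∞ F halfPlane ∧ ∀ q : ℝ × ℝ, 0 < q.1 → |q.2 - t₀| < δ →
      (1 / 2) * (q.1 * fderivWithin ℝ F halfPlane q (1, 0) +
        Complex.I * fderivWithin ℝ F halfPlane q (0, 1)) = φ q := by
  set G := mellinConv (gaussCauchyKernel (2 * δ + 1)) φ with hG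
  have hGs : ContDiffOn ℝ ∞ G halfPlane :=
    contDiffOn_mellinConv hφ (isRapid_gaussCauchyKernel _)
  -- The convolution yields `2π φ`; the factor `½` in the equation leaves `π` to divide by.
  refine ⟨(Real.pi : ℂ)⁻¹ • G, contDiffOn_const.smul hGs, fun q hq hqt => ?_⟩
  have hqS : q ∈ halfPlane := mem_halfPlane.2 hq.le
  -- Two angles within `δ` of `t₀` differ by less than `2 δ`.
  have h := mellinConv_gaussCauchyKernel hφ (M := 2 * δ + 1) (M' := 2 * δ) (by linarith) hq
    fun p hp hpq => hs p hp (by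
      have := abs_sub_le q.2 t₀ p.2
      rw [abs_sub_comm t₀] at this
      linarith)
  rw [← hG] at h
  rw [fderivWithin_const_smul (uniqueDiffOn_halfPlane q hqS)
    (hGs.differentiableOn (by simp) q hqS)]
  have hpi : (Real.pi : ℂ) ≠ 0 := by exact_mod_cast Real.pi_ne_zero
  simp only [smul_apply, smul_eq_mul]
  field_simp
  linear_combination h

/-! ### Cutting off, and passing between polar coordinates and the blow-up -/

theorem isTest_bump_mul {ψ : ℝ × ℝ → ℂ} {O : Set (ℝ × ℝ)} (hO : IsOpen O)
    (hψ : ContDiffOn ℝ ∞ ψ (halfPlane ∩ O)) {c : ℝ × ℝ} (b : ContDiffBump c)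
    (hb : Metric.closedBall c b.rOut ⊆ O) : IsTest fun q => b q • ψ q where
  smooth q hq := by
    by_cases hqO : q ∈ O
    · have h1 : ContDiffWithinAt ℝ ∞ ψ halfPlane q := (hψ q ⟨hq, hqO⟩).mono_of_mem_nhdsWithin
        (inter_mem_nhdsWithin _ (hO.mem_nhds hqO))
      exact b.contDiff.contDiffAt.contDiffWithinAt.smul h1
    · have hq' : q ∉ tsupport b := fun h => hqO (hb (by rwa [b.tsupport_eq] at h))
      have h0 : (fun q => b q • ψ q) =ᶠ[𝓝 q] fun _ => 0 := by
        filter_upwards [notMem_tsupport_iff_eventuallyEq.1 hq'] with y hy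
        rw [hy, Pi.zero_apply, zero_smul]
      exact (contDiffAt_const.congr_of_eventuallyEq h0).contDiffWithinAt
  bddSupport := by
    refine ⟨‖c‖ + b.rOut, fun q _ hq => ?_⟩
    have : b q = 0 := b.zero_of_le_dist (by
      rw [dist_eq_norm]
      linarith [norm_sub_norm_le q c])
    simp [this]

/-- The angle of a point of the circle, in the branch around `t₀`. -/
noncomputable def angle (t₀ : ℝ) (u : Circle) : ℝ :=
  t₀ + Complex.arg ((u / Circle.exp t₀ : Circle) : ℂ)

theorem exp_angle (t₀ : ℝ) (u : Circle) : Circle.exp (angle t₀ u) = u := by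
  rw [angle, Circle.exp_add, Circle.exp_arg, mul_div_cancel]

theorem angle_exp {t₀ t : ℝ} (h : |t - t₀| < Real.pi) : angle t₀ (Circle.exp t) = t := by
  rw [angle, ← Circle.exp_sub, Circle.arg_exp (neg_lt_of_abs_lt h) (le_of_abs_le h.le)]
  ring

/-- Cosine decreases on `[0, π]`. Nearness of angles is thus expressed by a real part, a manifestly
open condition on the circle, although `angle` itself jumps opposite to `t₀`. -/
theorem abs_angle_sub_lt {t₀ δ : ℝ} {u : Circle} (h0 : 0 ≤ δ)
    (h : Real.cos δ < ((u / Circle.exp t₀ : Circle) : ℂ).re) : |angle t₀ u - t₀| < δ := by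
  rw [angle, add_sub_cancel_left]
  by_contra! hle
  have h1 := Real.cos_le_cos_of_nonneg_of_le_pi h0 (Complex.abs_arg_le_pi _) hle
  rw [Real.cos_abs, Complex.cos_arg (Circle.coe_ne_zero _), Circle.norm_coe, div_one] at h1
  exact h.not_ge h1

/-- Positive real part places the quotient in the slit plane, where the principal logarithm is
smooth. -/
theorem contDiffAt_angle_exp {t₀ t : ℝ} (h : 0 < ((Circle.exp t / Circle.exp t₀ : Circle) : ℂ).re) :
    ContDiffAt ℝ ∞ (fun t => angle t₀ (Circle.exp t)) t := by
  have e : ∀ t, ((Circle.exp t / Circle.exp t₀ : Circle) : ℂ) =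
      Complex.exp (((t - t₀ : ℝ) : ℂ) * Complex.I) := fun t => by
    rw [← Circle.exp_sub, Circle.coe_exp]
  simp only [angle, ← Complex.log_im, e]
  rw [e] at h
  have h1 : ContDiff ℝ ∞ fun t : ℝ => Complex.exp (((t - t₀ : ℝ) : ℂ) * Complex.I) :=
    ((Complex.ofRealCLM.contDiff.comp (contDiff_id.sub contDiff_const)).mul contDiff_const).cexp
  have h2 : ContDiffAt ℝ ∞ Complex.log (Complex.exp (((t - t₀ : ℝ) : ℂ) * Complex.I)) :=
    (Complex.contDiffAt_log (Or.inl h)).restrict_scalars ℝ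
  have h3 : ContDiffAt ℝ ∞ Complex.im (Complex.log
      (Complex.exp (((t - t₀ : ℝ) : ℂ) * Complex.I))) := Complex.imCLM.contDiff.contDiffAt
  have h4 := h2.fun_comp t h1.contDiffAt
  exact contDiffAt_const.add (h3.fun_comp t h4)

variable {R : ℝ}

/-- Points of `V` whose polar coordinates have distance less than `δ` from `(r₀, t₀)`. -/
def polarBox (V : Opens (Space R)) (r₀ t₀ δ : ℝ) : Opens (Space R) where
  carrier := {y | y ∈ V ∧ |y.1.1 - r₀| < δ ∧
    Real.cos δ < ((y.1.2 / Circle.exp t₀ : Circle) : ℂ).re}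
  is_open' := by
    refine V.isOpen.inter ((isOpen_lt (f := fun y : Space R => |y.1.1 - r₀|)
      ?_ continuous_const).inter (isOpen_lt continuous_const (Complex.continuous_re.comp ?_)))
    · exact ((continuous_fst.comp continuous_subtype_val).sub continuous_const).abs
    · exact continuous_subtype_val.comp ((continuous_div_right' (Circle.exp t₀)).comp
        (continuous_snd.comp continuous_subtype_val))

/-- A function of the polar coordinates, as a function on the blow-up, in the branch around
`t₀`. -/
noncomputable def ofPolar (F : ℝ × ℝ → ℂ) (t₀ : ℝ) (V : Opens (Space R)) (y : V) : ℂ :=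
  F (y.1.1.1, angle t₀ y.1.1.2)

theorem inPolar_ofPolar (F : ℝ × ℝ → ℂ) (t₀ : ℝ) (V : Opens (Space R)) :
    EqOn (inPolar (ofPolar F t₀ V)) (fun q => F (q.1, angle t₀ (Circle.exp q.2)))
      (polarDomain V) := by
  rintro q ⟨y, hy, hyq⟩
  rw [inPolar_eq _ ⟨y, hy⟩ hyq, ofPolar, hyq]
  rfl

theorem isSmooth_ofPolar {F : ℝ × ℝ → ℂ} (hF : ContDiffOn ℝ ∞ F halfPlane) {V : Opens (Space R)}
    {r₀ t₀ δ : ℝ} (h0 : 0 ≤ δ) (hδ : δ < Real.pi / 2) :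
    IsSmooth (ofPolar F t₀ (polarBox V r₀ t₀ δ)) := by
  refine ContDiffOn.congr ?_ (inPolar_ofPolar F t₀ _)
  refine hF.comp (t := halfPlane) (f := fun q : ℝ × ℝ => (q.1, angle t₀ (Circle.exp q.2))) ?_ ?_
  · rintro q ⟨y, hy, hyq⟩
    refine ContDiffAt.contDiffWithinAt (contDiffAt_fst.prodMk ?_)
    refine ContDiffAt.fun_comp q (g := fun t => angle t₀ (Circle.exp t)) (contDiffAt_angle_exp ?_)
      contDiffAt_snd
    have h1 := hy.2.2
    rw [hyq] at h1
    exact (Real.cos_pos_of_mem_Ioo ⟨by linarith, hδ⟩).trans h1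
  · rintro q ⟨y, hy, hyq⟩
    have := y.2.1
    rw [hyq] at this
    exact mem_halfPlane.2 this

/-- Periodicity replaces the principal argument in `dbarCoeff` by the branch around `t₀`. Off `E`
the point is interior, and there `ofPolar F` read in this branch is locally `F`. -/
theorem dbarCoeff_ofPolar (F : ℝ × ℝ → ℂ) (t₀ : ℝ) (V : Opens (Space R)) (y : V)
    (hy : y.1 ∉ excDivisor R) (ht : |angle t₀ y.1.1.2 - t₀| < Real.pi) :
    dbarCoeff (ofPolar F t₀ V) y = (1 / 2) * (y.1.1.1 *
      fderivWithin ℝ F halfPlane (y.1.1.1, angle t₀ y.1.1.2) (1, 0) +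
        Complex.I * fderivWithin ℝ F halfPlane (y.1.1.1, angle t₀ y.1.1.2) (0, 1)) := by
  have hr : 0 < y.1.1.1 := notMem_excDivisor.1 hy
  have hyq : y.1.1 = polar (y.1.1.1, angle t₀ y.1.1.2) := Prod.ext rfl (exp_angle _ _).symm
  rw [dbarCoeff, polarDbar_congr _ (t := angle t₀ y.1.1.2) (by rw [Circle.exp_arg, exp_angle])]
  set q : ℝ × ℝ := (y.1.1.1, angle t₀ y.1.1.2) with hq
  have hV : polarDomain V ∈ 𝓝 q := polarDomain_mem_nhds ⟨y.1, y.2, hyq⟩ hr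
  have hev : inPolar (ofPolar F t₀ V) =ᶠ[𝓝 q] F := by
    have h1 : ∀ᶠ p : ℝ × ℝ in 𝓝 q, |p.2 - t₀| < Real.pi :=
      (isOpen_lt (by fun_prop) continuous_const).mem_nhds ht
    filter_upwards [hV, h1] with p hp hpt
    rw [inPolar_ofPolar F t₀ V hp]
    simp only [angle_exp hpt]
  rw [polarDbar, fderivWithin_of_mem_nhds hV, hev.fderiv_eq,
    fderivWithin_of_mem_nhds (halfPlane_mem_nhds (q := q) hr)]

/-- The local `∂̄`-lemma. Writing `α = ψ dz̄ / z̄`, the equation becomes `z̄ ∂f/∂z̄ = ψ`, which is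
the polar equation for a cutoff of `ψ`. It need only be checked off `E`, since forms carry no datum
on `E`. -/
theorem IsLogForm.exists_dbar_eq {U : Opens (Space R)} {α : ∀ x : U, FormFibre x.1}
    (hα : IsLogForm α) {x : Space R} (hx : x ∈ U) :
    ∃ (V : Opens (Space R)) (hV : V ≤ U), x ∈ V ∧ ∃ f : V → ℂ, IsSmooth f ∧
      ∀ y : V, dbar f y = α ⟨y, hV y.2⟩ := by
  obtain ⟨W, hW, hxW, ψ, hψ, hψα⟩ := hα x hx
  obtain ⟨t₀, ht₀⟩ := exists_polar x
  set r₀ := x.1.1 with hr₀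
  obtain ⟨O, hO, hWO⟩ := exists_isOpen_polarDomain W
  have hqO : (r₀, t₀) ∈ O := by
    have : (r₀, t₀) ∈ polarDomain W := ⟨x, hxW, ht₀⟩
    rw [hWO] at this
    exact this.2
  obtain ⟨ε, hε, hεO⟩ := Metric.nhds_basis_closedBall.mem_iff.1 (hO.mem_nhds hqO)
  -- The bound by `1` keeps the box within a quarter turn of `t₀`, where `angle` is smooth.
  set δ := min ε 1 with hδ
  have hδ0 : 0 < δ := lt_min hε one_pos
  have hδ1 : δ ≤ 1 := min_le_right _ _
  have hpi := Real.pi_gt_three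
  -- Balls of `ℝ × ℝ` are boxes for the sup metric: `b` vanishes once the angle alone is `δ` away,
  -- and equals `1` on the box of size `δ / 2` where the equation is solved.
  let b : ContDiffBump ((r₀, t₀) : ℝ × ℝ) := ⟨δ / 2, δ, by linarith, by linarith⟩
  have hφ : IsTest fun q => b q • inPolar ψ q :=
    isTest_bump_mul hO (by have := hψ; rwa [IsSmooth, hWO] at this) b
      ((Metric.closedBall_subset_closedBall (min_le_left _ _)).trans hεO)
  obtain ⟨F, hF, hFφ⟩ := exists_polar_solution hφ (t₀ := t₀) (δ := δ) fun p _ hp => by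
    have : b p = 0 := b.zero_of_le_dist (hp.trans
      ((Real.dist_eq p.2 t₀).symm.le.trans (le_max_right (dist p.1 r₀) _)))
    rw [this, zero_smul]
  set V := polarBox W r₀ t₀ (δ / 2) with hV
  have hVW : V ≤ W := fun y hy => hy.1
  have hf : IsSmooth (ofPolar F t₀ V) := isSmooth_ofPolar hF (by linarith) (by linarith)
  refine ⟨V, hVW.trans hW, ⟨hxW, ?_, ?_⟩, ofPolar F t₀ V, hf, fun y => ?_⟩
  · rw [sub_self, abs_zero]
    linarith
  · have h1 : x.1.2 = Circle.exp t₀ := congrArg Prod.snd ht₀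
    rw [h1, div_self', Circle.coe_one, Complex.one_re, ← Real.cos_zero]
    exact Real.cos_lt_cos_of_nonneg_of_le_pi le_rfl (by linarith) (by linarith)
  funext hy
  obtain ⟨hy⟩ := hy
  have hang : |angle t₀ y.1.1.2 - t₀| < δ / 2 :=
    abs_angle_sub_lt (by linarith) y.2.2.2
  have hyr := notMem_excDivisor.1 hy
  have hyq : y.1.1 = polar (y.1.1.1, angle t₀ y.1.1.2) := Prod.ext rfl (exp_angle _ _).symm
  have hb : b (y.1.1.1, angle t₀ y.1.1.2) = 1 := b.one_of_mem_closedBall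
    (max_le (y.2.2.1.le) hang.le)
  have h1 := dbarCoeff_ofPolar F t₀ V y hy (by linarith)
  rw [hFφ (y.1.1.1, angle t₀ y.1.1.2) hyr (by linarith), hb, one_smul,
    inPolar_eq ψ ⟨y.1, hVW y.2⟩ hyq, dbarCoeff_eq hf y hy] at h1
  have h0 : conj (blowDown y.1) ≠ 0 := (map_ne_zero _).2 hy
  rw [hψα ⟨y.1, hVW y.2⟩ hy, ← h1, mul_div_cancel_left₀ _ h0]
  rfl

/-! ### Exactness of the sequence of sheaves -/

theorem differentiableAt_of_wirtingerBar_eq_zero {g : ℂ → ℂ} {z : ℂ}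
    (hg : DifferentiableAt ℝ g z) (h : wirtingerBar g z = 0) : DifferentiableAt ℂ g z := by
  refine differentiableAt_complex_iff_differentiableAt_real.2 ⟨hg, ?_⟩
  have h' : fderiv ℝ g z 1 + Complex.I * fderiv ℝ g z Complex.I = 0 := by
    simpa [wirtingerBar] using h
  rw [smul_eq_mul]
  linear_combination (-Complex.I) * h' + fderiv ℝ g z Complex.I * Complex.I_mul_I

theorem dzbar_ne_zero : dzbar ≠ 0 := fun h => by
  have := LinearMap.congr_fun h 1
  simp [dzbar] at this

theorem isHolomorphicOffE_of_dbar_eq_zero {U : Opens (Space R)} {f : U → ℂ} (hf : IsSmooth f)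
    (h : dbar f = 0) : IsHolomorphicOffE f := fun x hx => by
  refine differentiableAt_of_wirtingerBar_eq_zero (hf.differentiableAt_inPlane x hx) ?_
  have h1 : wirtingerBar (inPlane f) (blowDown x.1) • dzbar = 0 :=
    congrFun (congrFun h x) ⟨hx⟩
  exact (smul_eq_zero.1 h1).resolve_right dzbar_ne_zero

instance mono_inclusion : Mono (inclusion R) := by
  constructor
  intro Z a b hab
  apply CategoryTheory.Sheaf.hom_ext
  ext U z
  have h1 := congrArg (fun k => (k.hom.app U).hom z) hab
  apply Subtype.ext
  exact congrArg (fun s : (smoothCondition R).sections U.unop => s.1) h1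

/-- The kernel of `∂̄` is `𝒪`. -/
noncomputable def inclusionIsKernel :
    Limits.IsLimit (Limits.KernelFork.ofι (inclusion R) (inclusion_comp_dbarHom R)) :=
  Limits.KernelFork.IsLimit.ofι' _ _ fun {Z} k hk =>
    -- A morphism killed by `∂̄` takes values in holomorphic sections over every open set, so it
    -- factors through `𝒪` section by section, with no passage to stalks.
    have key : ∀ (U : (Opens (Space R))ᵒᵖ) (z : Z.obj.obj U),
        IsHolomorphicOffE ((k.hom.app U).hom z).1 := fun U z => by
      refine isHolomorphicOffE_of_dbar_eq_zero ((k.hom.app U).hom z).2 ?_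
      exact congrArg (fun s : (logFormCondition R).sections U.unop => s.1)
        (congrArg (fun k => (k.hom.app U).hom z) hk)
    ⟨⟨{ app := fun U => ModuleCat.ofHom
          { toFun := fun z => ⟨((k.hom.app U).hom z).1, ((k.hom.app U).hom z).2, key U z⟩
            map_add' := fun a b => by
              apply Subtype.ext
              exact congrArg (fun s : (smoothCondition R).sections U.unop => s.1) (map_add (k.hom.app U).hom a b)
            map_smul' := fun c a => by
              apply Subtype.ext
              exact congrArg (fun s : (smoothCondition R).sections U.unop => s.1) (map_smul (k.hom.app U).hom c a) }
        naturality := by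
          intro U V i
          ext z
          apply Subtype.ext
          exact congrArg (fun s : (smoothCondition R).sections V.unop => s.1)
            (congrArg (fun k => k.hom z) (k.hom.naturality i)) }⟩, by
      apply CategoryTheory.Sheaf.hom_ext
      ext U z
      rfl⟩

/-- Epimorphisms of sheaves of modules are the locally surjective morphisms, so local solvability
suffices. -/
theorem epi_dbarHom (h : ∀ (U : Opens (Space R)) (α : ∀ x : U, FormFibre x.1), IsLogForm α →
    ∀ x ∈ U, ∃ (V : Opens (Space R)) (hV : V ≤ U), x ∈ V ∧ ∃ f : V → ℂ, IsSmooth f ∧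
      ∀ y : V, dbar f y = α ⟨y, hV y.2⟩) : Epi (dbarHom R) := by
  refine (CategoryTheory.Sheaf.isLocallySurjective_iff_epi' (ModuleCat.{0} ℂ) (dbarHom R)).1 ?_
  refine (TopCat.Presheaf.isLocallySurjective_iff (dbarHom R).hom).2 fun U α x hx => ?_
  obtain ⟨V, hV, hxV, f, hf, hfα⟩ := h U α.1 α.2 x hx
  refine ⟨V, hV, ⟨⟨f, hf⟩, ?_⟩, hxV⟩
  apply Subtype.ext
  funext y
  exact hfα y

theorem shortExact_of_locallySolvable (h : ∀ (U : Opens (Space R)) (α : ∀ x : U, FormFibre x.1),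
    IsLogForm α → ∀ x ∈ U, ∃ (V : Opens (Space R)) (hV : V ≤ U), x ∈ V ∧ ∃ f : V → ℂ,
      IsSmooth f ∧ ∀ y : V, dbar f y = α ⟨y, hV y.2⟩) : (logDolbeault R).ShortExact where
  exact := ShortComplex.exact_of_f_is_kernel _ inclusionIsKernel
  mono_f := mono_inclusion
  epi_g := epi_dbarHom h

end RealBlowup

theorem mainTheorem11 (R : ℝ) (hR : 0 < R) :
    (RealBlowup.logDolbeault R).ShortExact := by
  exact RealBlowup.shortExact_of_locallySolvable fun _ _ hα _ hx => hα.exists_dbar_eq hx
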